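/- **Soundness of a typed $\lambda$-calculus with ordered resources.** *Ordered partial monoids.* An OPM is a set $\mathbb M$ with a preorder $\le$, an element $\varepsilon$ and a partial binary operation $\odot$ such that $m\odot\varepsilon=\varepsilon\odot m=m$ (always defined); $(m\odot n)\odot o=m\odot(n\odot o)$, where one side is defined iff the other is; and if $m\le m'$, $n\le n'$ and $m'\odot n'$ is defined, then $m\odot n$ is defined and $m\odot n\le m'\odot n'$. Below, $m_1\odot m_2\le m_0$ means that the product is defined and $\le m_0$. Fix an OPM, and countably infinite sets of variables $x,y$ and of locations $l$. *Syntax.* Constants $c::=\mathtt{unit}\mid\mathtt{new}_m\mid\mathtt{op}_m\mid\mathtt{split}_{m_1,m_2}\mid\mathtt{drop}$. Expressions $$M,N::=c\mid l\mid x\mid\lambda x.M\mid\lambda^\circ x.M\mid\lambda^{>}x.M\mid\lambda^{<}x.M\mid M\,N\mid M{}^\circ N\mid M{}^{>}N\mid M{}^{<}N\mid M\otimes N\mid M\odot N\mid \mathtt{let}\,x\otimes y=M\,\mathtt{in}\,N\mid\mathtt{let}\,x\odot y=M\,\mathtt{in}\,N .$$ Values $V::=c\mid l\mid\text{any of the four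 abstractions}\mid V_1\otimes V_2\mid V_1\odot V_2$. Evaluation contexts $$\mathcal E::=[\,]\mid\mathcal E\,M\mid V\,\mathcal E\mid\mathcal E{}^\circ M\mid V{}^\circ\mathcal E\mid\mathcal E{}^{>}M\mid V{}^{>}\mathcal E\mid\mathcal E{}^{<}V\mid M{}^{<}\mathcal E\mid\mathcal E\otimes M\mid V\otimes\mathcal E\mid\mathcal E\odot M\mid V\odot\mathcal E\mid\mathtt{let}\,x\otimes y=\mathcal E\,\mathtt{in}\,M\mid\mathtt{let}\,x\odot y=\mathcal E\,\mathtt{in}\,M .$$ *Evaluation.* A heap $H$ is a finite map from locations to triples $(n,m_0,m)$ (reference count, where $0$ denotes one reference; usage specified at creation; trace of the operations performed so far). Expression reduction $\to_\beta$: each of the four applications of an abstraction of the same kind with body $M$ to a value $V$ reduces to $M[V/x]$; and for $x\ne y$, $\mathtt{let}\,x\otimes y=V_1\otimes V_2\,\mathtt{in}\,M\to_\beta M[V_1/x][V_2/y]$, and likewise with $\odot$ in place of $\otimes$. Configuration reduction $\to_\gamma$: - $\mathtt{new}_m\,\mathtt{unit}\mid H\to_\gamma l\mid H\cup\{l\mapsto(0,m,\varepsilon)\}$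 for any $l\notin\mathrm{dom}(H)$; - $\mathtt{op}_m\,l\mid H\cup\{l\mapsto(n,m_0,m')\}\to_\gamma l\mid H\cup\{l\mapsto(n,m_0,m'\odot m)\}$ if $m'\odot m$ is defined and $(m'\odot m)\odot m''\le m_0$ for some $m''$; - $\mathtt{drop}\,l\mid H\cup\{l\mapsto(n+1,m_0,m)\}\to_\gamma\mathtt{unit}\mid H\cup\{l\mapsto(n,m_0,m)\}$; - $\mathtt{drop}\,l\mid H\cup\{l\mapsto(0,m_0,m)\}\to_\gamma\mathtt{unit}\mid H$ if $l\notin\mathrm{dom}(H)$ and $m\le m_0$; - $\mathtt{split}_{m_1,m_2}\,l\mid H\cup\{l\mapsto(n,m_0,m)\}\to_\gamma l\odot l\mid H\cup\{l\mapsto(n+1,m_0,m)\}$. (Here $H\cup\{l\mapsto\cdot\}$ denotes the updated map.) Finally $\mathcal E[M]\mid H\to\mathcal E[M']\mid H'$ if $M\mid H\to_\gamma M'\mid H'$, or if $M\to_\beta M'$ and $H'=H$. A configuration diverges if it starts an infinite $\to$-sequence; $\to^*$ is the reflexive transitive closure of $\to$. *Types.* Effects are $e\in\{0,1\}$ with $0\le1$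 and maximum $\sqcup$. Types are $T,S::=\mathtt{Unit}\mid[m]\mid S\to_eT\mid S\rightarrowtriangle_eT\mid S\twoheadrightarrow_eT\mid S\rightarrowtail_eT\mid S\otimes T\mid S\odot T$. The unrestricted types are $\mathtt{Unit}$, all $S\to_eT$, and the products $S\otimes T$ and $S\odot T$ of unrestricted $S$, $T$; all other types are ordered. Contexts are $\Gamma::=\cdot\mid x:T\mid l:[m]\mid\Gamma_1,\Gamma_2\mid\Gamma_1\parallel\Gamma_2$; a pattern $\mathcal G$ is a context with one hole. A binding is unrestricted or ordered as its type is; $\Gamma$ is unrestricted if all its bindings are. A context is interpreted as the finite directed graph, labelled by bindings, whose vertices are the occurrences of ordered bindings and where $\Gamma_1,\Gamma_2$ is the disjoint union of the two graphs plus all edges from the first to the second, and $\Gamma_1\parallel\Gamma_2$ is the disjoint union; together with the set of unrestricted bindings that occur in it. Write $\Gamma_1\lesssim\Gamma_2$ if there is a label-preserving bijection from the vertices of $\Gamma_1$ to those of $\Gamma_2$ that maps edges to edges, and the unrestricted bindings of $\Gamma_2$ are among those of $\Gamma_1$. *Typing* $\Gamma\vdash M:T\mid e$ is generated by the following rules.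 - $\cdot\vdash\mathtt{unit}:\mathtt{Unit}\mid0$; $\;\cdot\vdash\mathtt{new}_m:\mathtt{Unit}\to_0[m]\mid0$; $\;\cdot\vdash\mathtt{op}_{m_1}:[m_0]\to_1[m_2]\mid0$ and $\cdot\vdash\mathtt{split}_{m_1,m_2}:[m_0]\to_0([m_1]\odot[m_2])\mid0$ if $m_1\odot m_2\le m_0$; $\;\cdot\vdash\mathtt{drop}:[m]\to_0\mathtt{Unit}\mid0$ if $\varepsilon\le m$; $\;x:T\vdash x:T\mid0$; $\;l:[m]\vdash l:[m]\mid0$. - For $x\notin\mathrm{dom}(\Gamma)$: $\Gamma\vdash\lambda x.M:S\to_eT\mid0$ if $\Gamma$ is unrestricted and $\Gamma,x:S\vdash M:T\mid e$; $\;\Gamma\vdash\lambda^\circ x.M:S\rightarrowtriangle_eT\mid0$ if $\Gamma\parallel x:S\vdash M:T\mid e$; $\;\Gamma\vdash\lambda^{>}x.M:S\twoheadrightarrow_eT\mid0$ if $\Gamma,x:S\vdash M:T\mid e$; $\;\Gamma\vdash\lambda^{<}x.M:S\rightarrowtail_eT\mid0$ if $x:S,\Gamma\vdash M:T\mid e$.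 - $\Gamma_1,\Gamma_2\vdash M\,N:T\mid e\sqcup e_1\sqcup e_2$ if $\Gamma_1\vdash M:S\to_eT\mid e_1$ and $\Gamma_2\vdash N:S\mid e_2$; $\;\Gamma_1\parallel\Gamma_2\vdash M{}^\circ N:T\mid e\sqcup e_1\sqcup e_2$ if $\Gamma_1\vdash M:S\rightarrowtriangle_eT\mid e_1$ and $\Gamma_2\vdash N:S\mid e_2$; $\;\Gamma_1,\Gamma_2\vdash M{}^{>}N:T\mid e\sqcup e_1$ if $\Gamma_1\vdash M:S\twoheadrightarrow_eT\mid e_1$ and $\Gamma_2\vdash N:S\mid0$; $\;\Gamma_1,\Gamma_2\vdash M{}^{<}N:T\mid e\sqcup e_2$ if $\Gamma_2\vdash M:S\rightarrowtail_eT\mid0$ and $\Gamma_1\vdash N:S\mid e_2$. - If $\Gamma_1\vdash M:S\mid e_1$ and $\Gamma_2\vdash N:T\mid e_2$, then $\Gamma_1\parallel\Gamma_2\vdash M\otimes N:S\otimes T\mid e_1\sqcup e_2$, and, provided that $e_2=0$ in case $S$ is ordered, $\Gamma_1,\Gamma_2\vdash M\odot N:S\odot T\mid e_1\sqcup e_2$.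 - For $x\ne y$ with $x,y\notin\mathrm{dom}(\mathcal G[\Gamma])$: $\mathcal G[\Gamma]\vdash\mathtt{let}\,x\otimes y=M\,\mathtt{in}\,N:T\mid e$ if $\Gamma\vdash M:S_1\otimes S_2\mid0$ and $\mathcal G[x:S_1\parallel y:S_2]\vdash N:T\mid e$; $\;\mathcal G[\Gamma]\vdash\mathtt{let}\,x\odot y=M\,\mathtt{in}\,N:T\mid e$ if $\Gamma\vdash M:S_1\odot S_2\mid0$ and $\mathcal G[x:S_1,\,y:S_2]\vdash N:T\mid e$. - $\Gamma_2\vdash M:T\mid e_2$ if $\Gamma_1\vdash M:T\mid e_1$, $\Gamma_2\lesssim\Gamma_1$ and $e_1\le e_2$. **Proposition (Soundness).** Suppose $\cdot\vdash M:T\mid e$ with $T$ unrestricted. Then $M\mid\{\}\to^*V\mid\{\}$ for some value $V$, or $M\mid\{\}$ diverges. Moreover, well-typed programs never get stuck, respect the specifications of their resources and dispose of all resources: whenever $M\mid\{\}\to^*M'\mid H$, either $M'$ is a value and $H=\{\}$, or $M'\mid H$ can take a further step; and for every entry $l\mapsto(n,m_0,m)$ of $H$ there is an $m'$ such that $m\odot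 m'$ is defined and $m\odot m'\le m_0$. -/

import Mathlib

namespace OrderedBorrow

universe u

/-- Ordered partial monoids. The product `pmul m n` is `none` exactly where it is undefined. The
equation `pmul_assoc` says that one side is defined iff the other is, and then both are equal.
The last law is monotonicity together with downward closure of definedness. -/
class OPM (M : Type u) extends Preorder M where
  pmul : M → M → Option M
  eps : M
  eps_pmul : ∀ m, pmul eps m = some m
  pmul_eps : ∀ m, pmul m eps = some m
  pmul_assoc : ∀ m n o,
    (pmul m n).bind (fun p => pmul p o) = (pmul n o).bind (fun q => pmul m q)
  pmul_mono : ∀ {m m' n n' p' : M}, m ≤ m' → n ≤ n' → pmul m' n' = some p' →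
    ∃ p, pmul m n = some p ∧ p ≤ p'

/-- `MulLE m₁ m₂ m`: the product `m₁ ⊙ m₂` is defined and `m₁ ⊙ m₂ ≤ m`. -/
def MulLE {M : Type u} [OPM M] (m₁ m₂ m : M) : Prop :=
  ∃ p, OPM.pmul m₁ m₂ = some p ∧ p ≤ m

abbrev Var := ℕ
abbrev Loc := ℕ

/-- Effects: `0` (no operation is performed) and `1` (an operation may be performed), with
composition `⊔` the maximum. -/
abbrev Eff := Fin 2

/-- The four sorts of abstraction, application and arrow type:
* `plain`: `λ x. M`, `M N`, `S → T` (captures no resource);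
* `unord`: `λ° x. M`, `M ° N`, the linear arrow (captured resources and argument unordered);
* `right`: `λ> x. M`, `M > N` (captured resources are consumed before those of the argument);
* `left`: `λ< x. M`, `M < N` (resources of the argument are consumed first). -/
inductive FunKind
  | plain | unord | right | left

/-- The two sorts of pairs, pair eliminations and product types:
`unord` for `⊗` and `ord` for `⊙`. -/
inductive PairKind
  | unord | ord

inductive Const (M : Type u) : Type u
  | unit
  | new (m : M)
  | op (m : M)
  | split (m₁ m₂ : M)
  | drop

/-- Expressions. `letPair p x y N₁ N₂` is `let x ⊗ y = N₁ in N₂`, respectively with `⊙`; it binds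
`x` and `y` in `N₂`. -/
inductive Term (M : Type u) : Type u
  | const (c : Const M)
  | loc (l : Loc)
  | var (x : Var)
  | lam (k : FunKind) (x : Var) (N : Term M)
  | app (k : FunKind) (N₁ N₂ : Term M)
  | pair (p : PairKind) (N₁ N₂ : Term M)
  | letPair (p : PairKind) (x y : Var) (N₁ N₂ : Term M)

inductive Term.IsValue {M : Type u} : Term M → Prop
  | const (c : Const M) : IsValue (.const c)
  | loc (l : Loc) : IsValue (.loc l)
  | lam (k : FunKind) (x : Var) (N : Term M) : IsValue (.lam k x N)
  | pair (p : PairKind) {V₁ V₂ : Term M} : V₁.IsValue → V₂.IsValue → IsValue (.pair p V₁ V₂)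

/-- Substitution `N[V/x]` of `V` for the free occurrences of `x`. Evaluation of a program (a term
without free variables) only ever substitutes terms `V` without free variables, since it does not go
under binders; hence no variable can be captured and no renaming of bound variables is needed. -/
def Term.subst {M : Type u} (N : Term M) (x : Var) (V : Term M) : Term M :=
  match N with
  | .const c => .const c
  | .loc l => .loc l
  | .var y => if y = x then V else .var y
  | .lam k y N => .lam k y (if y = x then N else N.subst x V)
  | .app k N₁ N₂ => .app k (N₁.subst x V) (N₂.subst x V)
  | .pair p N₁ N₂ => .pair p (N₁.subst x V) (N₂.subst x V)
  | .letPair p y z N₁ N₂ =>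
      .letPair p y z (N₁.subst x V) (if y = x ∨ z = x then N₂ else N₂.subst x V)

/-- Evaluation contexts. Evaluation goes from left to right, except in applications `M < N`, which
are evaluated from right to left. -/
inductive ECtx (M : Type u) : Type u
  | hole
  | appFun (k : FunKind) (hk : k ≠ .left) (E : ECtx M) (N : Term M)
  | appArg (k : FunKind) (hk : k ≠ .left) (V : Term M) (hV : V.IsValue) (E : ECtx M)
  | leftFun (E : ECtx M) (V : Term M) (hV : V.IsValue)
  | leftArg (N : Term M) (E : ECtx M)
  | pairFst (p : PairKind) (E : ECtx M) (N : Term M)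
  | pairSnd (p : PairKind) (V : Term M) (hV : V.IsValue) (E : ECtx M)
  | letPair (p : PairKind) (x y : Var) (E : ECtx M) (N : Term M)

def ECtx.fill {M : Type u} : ECtx M → Term M → Term M
  | .hole, P => P
  | .appFun k _ E N, P => .app k (E.fill P) N
  | .appArg k _ V _ E, P => .app k V (E.fill P)
  | .leftFun E V _, P => .app .left (E.fill P) V
  | .leftArg N E, P => .app .left N (E.fill P)
  | .pairFst p E N, P => .pair p (E.fill P) N
  | .pairSnd p V _ E, P => .pair p V (E.fill P)
  | .letPair p x y E N, P => .letPair p x y (E.fill P) N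

/-- The triple `(n, m₀, m)` that a heap stores at a location: the reference count (where `0` stands
for one reference), the usage specified at creation, the trace of operations performed so far. -/
structure Cell (M : Type u) : Type u where
  count : ℕ
  usage : M
  trace : M

/-- Heaps: finite maps from locations to triples. -/
abbrev Heap (M : Type u) : Type u := Finmap (fun _ : Loc => Cell M)

/-- Expression reduction. -/
inductive BetaStep {M : Type u} : Term M → Term M → Prop
  | beta (k : FunKind) (x : Var) (N V : Term M) (hV : V.IsValue) :
      BetaStep (.app k (.lam k x N) V) (N.subst x V)
  | letPair (p : PairKind) (x y : Var) (V₁ V₂ N : Term M) (hxy : x ≠ y)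
      (hV₁ : V₁.IsValue) (hV₂ : V₂.IsValue) :
      BetaStep (.letPair p x y (.pair p V₁ V₂) N) ((N.subst x V₁).subst y V₂)

/-- Configuration reduction. `H.insert l c` is the heap that maps `l` to `c` and agrees with `H`
elsewhere. -/
inductive CfgStep {M : Type u} [OPM M] : Term M → Heap M → Term M → Heap M → Prop
  | new (m : M) (l : Loc) (H : Heap M) (hl : l ∉ H) :
      CfgStep (.app .plain (.const (.new m)) (.const .unit)) H
        (.loc l) (H.insert l ⟨0, m, OPM.eps⟩)
  | op (m : M) (l : Loc) (H : Heap M) (n : ℕ) (m₀ m' p : M)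
      (hl : H.lookup l = some ⟨n, m₀, m'⟩)
      (hp : OPM.pmul m' m = some p) (hadm : ∃ m'', MulLE p m'' m₀) :
      CfgStep (.app .plain (.const (.op m)) (.loc l)) H
        (.loc l) (H.insert l ⟨n, m₀, p⟩)
  | dropShared (l : Loc) (H : Heap M) (n : ℕ) (m₀ m : M)
      (hl : H.lookup l = some ⟨n + 1, m₀, m⟩) :
      CfgStep (.app .plain (.const .drop) (.loc l)) H
        (.const .unit) (H.insert l ⟨n, m₀, m⟩)
  | dropLast (l : Loc) (H : Heap M) (m₀ m : M)
      (hl : H.lookup l = some ⟨0, m₀, m⟩) (hm : m ≤ m₀) :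
      CfgStep (.app .plain (.const .drop) (.loc l)) H
        (.const .unit) (H.erase l)
  | split (m₁ m₂ : M) (l : Loc) (H : Heap M) (n : ℕ) (m₀ m : M)
      (hl : H.lookup l = some ⟨n, m₀, m⟩) :
      CfgStep (.app .plain (.const (.split m₁ m₂)) (.loc l)) H
        (.pair .ord (.loc l) (.loc l)) (H.insert l ⟨n + 1, m₀, m⟩)

abbrev Config (M : Type u) : Type u := Term M × Heap M

/-- Contextual reduction of configurations. -/
inductive Step {M : Type u} [OPM M] : Config M → Config M → Prop
  | exp (E : ECtx M) (N N' : Term M) (H : Heap M) :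
      BetaStep N N' → Step (E.fill N, H) (E.fill N', H)
  | cfg (E : ECtx M) (N N' : Term M) (H H' : Heap M) :
      CfgStep N H N' H' → Step (E.fill N, H) (E.fill N', H')

/-- Reduction in finitely many (possibly zero) steps. -/
def Steps {M : Type u} [OPM M] : Config M → Config M → Prop :=
  Relation.ReflTransGen Step

/-- There is an infinite reduction sequence from the given configuration. -/
def Diverges {M : Type u} [OPM M] (c : Config M) : Prop :=
  ∃ f : ℕ → Config M, f 0 = c ∧ ∀ i, Step (f i) (f (i + 1))

/-- Types. -/
inductive Ty (M : Type u) : Type u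
  | unit
  | res (m : M)
  | arrow (k : FunKind) (S : Ty M) (e : Eff) (T : Ty M)
  | prod (p : PairKind) (S T : Ty M)

/-- Unrestricted types. -/
inductive Ty.Unr {M : Type u} : Ty M → Prop
  | unit : Unr .unit
  | arrow (S : Ty M) (e : Eff) (T : Ty M) : Unr (.arrow .plain S e T)
  | prod (p : PairKind) {S T : Ty M} : S.Unr → T.Unr → Unr (.prod p S T)

/-- Ordered types. -/
inductive Ty.Ord {M : Type u} : Ty M → Prop
  | res (m : M) : Ord (.res m)
  | arrow (k : FunKind) (hk : k ≠ .plain) (S : Ty M) (e : Eff) (T : Ty M) :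
      Ord (.arrow k S e T)
  | prodFst (p : PairKind) {S : Ty M} (T : Ty M) : S.Ord → Ord (.prod p S T)
  | prodSnd (p : PairKind) (S : Ty M) {T : Ty M} : T.Ord → Ord (.prod p S T)

/-- Every type is either ordered or unrestricted, and not both. -/
theorem Ty.ord_iff_not_unr {M : Type u} (T : Ty M) : T.Ord ↔ ¬ T.Unr := by
  induction T with
  | unit => exact ⟨(fun h => by cases h), fun h => absurd Unr.unit h⟩
  | res m => exact ⟨(fun _ h => by cases h), fun _ => Ord.res m⟩
  | arrow k S e T _ _ =>
    constructor
    · intro h h'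
      cases h'
      cases h with
      | arrow _ hk => exact hk rfl
    · intro h
      refine Ord.arrow k ?_ S e T
      rintro rfl
      exact h (Unr.arrow S e T)
  | prod p S T ihS ihT =>
    constructor
    · intro h h'
      cases h' with
      | prod _ hS hT =>
        cases h with
        | prodFst _ _ h => exact ihS.1 h hS
        | prodSnd _ _ h => exact ihT.1 h hT
    · intro h
      by_cases hS : S.Unr
      · exact Ord.prodSnd p S (ihT.2 fun hT => h (Unr.prod p hS hT))
      · exact Ord.prodFst p T (ihS.2 hS)

/-- Bindings `x : T` and `l : [m]`. -/
inductive Binding (M : Type u) : Type u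
  | var (x : Var) (T : Ty M)
  | loc (l : Loc) (m : M)

def Binding.ty {M : Type u} : Binding M → Ty M
  | .var _ T => T
  | .loc _ m => .res m

def Binding.name {M : Type u} : Binding M → Var ⊕ Loc
  | .var x _ => Sum.inl x
  | .loc l _ => Sum.inr l

/-- Typing contexts: `seq Γ₁ Γ₂` is `Γ₁, Γ₂` and `par Γ₁ Γ₂` is `Γ₁ ∥ Γ₂`. -/
inductive Ctx (M : Type u) : Type u
  | empty
  | single (b : Binding M)
  | seq (Γ₁ Γ₂ : Ctx M)
  | par (Γ₁ Γ₂ : Ctx M)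

/-- The one-binding context `x : T`. -/
abbrev Ctx.var {M : Type u} (x : Var) (T : Ty M) : Ctx M := .single (.var x T)

/-- The set of variables and locations bound in a context. -/
def Ctx.dom {M : Type u} : Ctx M → Set (Var ⊕ Loc)
  | .empty => ∅
  | .single b => {b.name}
  | .seq Γ₁ Γ₂ => Γ₁.dom ∪ Γ₂.dom
  | .par Γ₁ Γ₂ => Γ₁.dom ∪ Γ₂.dom

/-- All bindings of the context are unrestricted. -/
def Ctx.Unr {M : Type u} : Ctx M → Prop
  | .empty => True
  | .single b => b.ty.Unr
  | .seq Γ₁ Γ₂ => Γ₁.Unr ∧ Γ₂.Unr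
  | .par Γ₁ Γ₂ => Γ₁.Unr ∧ Γ₂.Unr

/-- Context patterns (contexts with one hole). -/
inductive CtxPat (M : Type u) : Type u
  | hole
  | seqRight (Γ : Ctx M) (G : CtxPat M)
  | seqLeft (G : CtxPat M) (Γ : Ctx M)
  | parRight (Γ : Ctx M) (G : CtxPat M)
  | parLeft (G : CtxPat M) (Γ : Ctx M)

def CtxPat.fill {M : Type u} : CtxPat M → Ctx M → Ctx M
  | .hole, Δ => Δ
  | .seqRight Γ G, Δ => .seq Γ (G.fill Δ)
  | .seqLeft G Γ, Δ => .seq (G.fill Δ) Γ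
  | .parRight Γ G, Δ => .par Γ (G.fill Δ)
  | .parLeft G Γ, Δ => .par (G.fill Δ) Γ

/-- Directed graphs on the vertices `0, …, n - 1` whose vertices are labelled by bindings. Those
that interpret contexts (see `Ctx.graph`), and all graphs isomorphic to them, are acyclic. -/
structure Graph (M : Type u) : Type u where
  n : ℕ
  label : Fin n → Binding M
  edge : Fin n → Fin n → Prop

/-- The join: the vertices of the second graph are shifted by the number of vertices of the first,
and `Sum.Lex` adds all edges from the first graph to the second. -/
def Graph.join {M : Type u} (G₁ G₂ : Graph M) : Graph M where
  n := G₁.n + G₂.n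
  label := fun i => Sum.elim G₁.label G₂.label (finSumFinEquiv.symm i)
  edge := fun i j => Sum.Lex G₁.edge G₂.edge (finSumFinEquiv.symm i) (finSumFinEquiv.symm j)

/-- The union: as the join, but without edges between the two graphs. -/
def Graph.union {M : Type u} (G₁ G₂ : Graph M) : Graph M where
  n := G₁.n + G₂.n
  label := fun i => Sum.elim G₁.label G₂.label (finSumFinEquiv.symm i)
  edge := fun i j => Sum.LiftRel G₁.edge G₂.edge (finSumFinEquiv.symm i) (finSumFinEquiv.symm j)

/-- Isomorphism of labelled graphs (a bijection `f` forces equal numbers of vertices). -/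
def Graph.Iso {M : Type u} (G₁ G₂ : Graph M) : Prop :=
  ∃ f : Fin G₂.n ≃ Fin G₁.n,
    (∀ i j, G₁.edge (f i) (f j) ↔ G₂.edge i j) ∧ ∀ i, G₁.label (f i) = G₂.label i

/-- `Spanning G₁ G₂`: same vertices and labels, and every edge of `G₁` is an edge of `G₂`. -/
inductive Graph.Spanning {M : Type u} : Graph M → Graph M → Prop
  | mk (n : ℕ) (v : Fin n → Binding M) (E₁ E₂ : Fin n → Fin n → Prop)
      (h : ∀ i j, E₁ i j → E₂ i j) : Spanning ⟨n, v, E₁⟩ ⟨n, v, E₂⟩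

open Classical in
/-- Graph part of the interpretation of a context: the graph of its ordered bindings. -/
noncomputable def Ctx.graph {M : Type u} : Ctx M → Graph M
  | .empty => ⟨0, Fin.elim0, fun _ _ => False⟩
  | .single b =>
      if b.ty.Unr then ⟨0, Fin.elim0, fun _ _ => False⟩
      else ⟨1, fun _ => b, fun _ _ => False⟩
  | .seq Γ₁ Γ₂ => Γ₁.graph.join Γ₂.graph
  | .par Γ₁ Γ₂ => Γ₁.graph.union Γ₂.graph

/-- Set part of the interpretation of a context: the set of its unrestricted bindings. -/
def Ctx.unrSet {M : Type u} : Ctx M → Set (Binding M)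
  | .empty => ∅
  | .single b => {b' | b' = b ∧ b.ty.Unr}
  | .seq Γ₁ Γ₂ => Γ₁.unrSet ∪ Γ₂.unrSet
  | .par Γ₁ Γ₂ => Γ₁.unrSet ∪ Γ₂.unrSet

/-- The subcontext relation `Γ₁ ≲ Γ₂`. -/
def Ctx.Sub {M : Type u} (Γ₁ Γ₂ : Ctx M) : Prop :=
  (∃ G₁ G₂ : Graph M, Γ₁.graph.Iso G₁ ∧ G₁.Spanning G₂ ∧ G₂.Iso Γ₂.graph) ∧
    Γ₂.unrSet ⊆ Γ₁.unrSet

/-- The typing judgment `Γ ⊢ N : T | e`.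

Call a context well-formed if it gives each variable only one type and binds each variable of
ordered type at most once. If the context of the conclusion of a rule is well-formed, then so are
the contexts of the premises; hence derivations from the empty context use well-formed contexts
only, and the rules need no such premise. -/
inductive Typing {M : Type u} [OPM M] : Ctx M → Term M → Ty M → Eff → Prop
  | unit : Typing .empty (.const .unit) .unit 0
  | new (m : M) : Typing .empty (.const (.new m)) (.arrow .plain .unit 0 (.res m)) 0
  | op (m₀ m₁ m₂ : M) (h : MulLE m₁ m₂ m₀) :
      Typing .empty (.const (.op m₁)) (.arrow .plain (.res m₀) 1 (.res m₂)) 0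
  | split (m₀ m₁ m₂ : M) (h : MulLE m₁ m₂ m₀) :
      Typing .empty (.const (.split m₁ m₂))
        (.arrow .plain (.res m₀) 0 (.prod .ord (.res m₁) (.res m₂))) 0
  | drop (m : M) (h : OPM.eps ≤ m) :
      Typing .empty (.const .drop) (.arrow .plain (.res m) 0 .unit) 0
  | var (x : Var) (T : Ty M) : Typing (.var x T) (.var x) T 0
  | loc (l : Loc) (m : M) : Typing (.single (.loc l m)) (.loc l) (.res m) 0
  | abs {Γ : Ctx M} {x : Var} {N : Term M} {S T : Ty M} {e : Eff}
      (hx : Sum.inl x ∉ Γ.dom) (hΓ : Γ.Unr)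
      (hN : Typing (.seq Γ (.var x S)) N T e) :
      Typing Γ (.lam .plain x N) (.arrow .plain S e T) 0
  | uabs {Γ : Ctx M} {x : Var} {N : Term M} {S T : Ty M} {e : Eff}
      (hx : Sum.inl x ∉ Γ.dom)
      (hN : Typing (.par Γ (.var x S)) N T e) :
      Typing Γ (.lam .unord x N) (.arrow .unord S e T) 0
  | rabs {Γ : Ctx M} {x : Var} {N : Term M} {S T : Ty M} {e : Eff}
      (hx : Sum.inl x ∉ Γ.dom)
      (hN : Typing (.seq Γ (.var x S)) N T e) :
      Typing Γ (.lam .right x N) (.arrow .right S e T) 0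
  | labs {Γ : Ctx M} {x : Var} {N : Term M} {S T : Ty M} {e : Eff}
      (hx : Sum.inl x ∉ Γ.dom)
      (hN : Typing (.seq (.var x S) Γ) N T e) :
      Typing Γ (.lam .left x N) (.arrow .left S e T) 0
  | app {Γ₁ Γ₂ : Ctx M} {N₁ N₂ : Term M} {S T : Ty M} {e e₁ e₂ : Eff}
      (h₁ : Typing Γ₁ N₁ (.arrow .plain S e T) e₁) (h₂ : Typing Γ₂ N₂ S e₂) :
      Typing (.seq Γ₁ Γ₂) (.app .plain N₁ N₂) T (e ⊔ e₁ ⊔ e₂)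
  | uapp {Γ₁ Γ₂ : Ctx M} {N₁ N₂ : Term M} {S T : Ty M} {e e₁ e₂ : Eff}
      (h₁ : Typing Γ₁ N₁ (.arrow .unord S e T) e₁) (h₂ : Typing Γ₂ N₂ S e₂) :
      Typing (.par Γ₁ Γ₂) (.app .unord N₁ N₂) T (e ⊔ e₁ ⊔ e₂)
  | rapp {Γ₁ Γ₂ : Ctx M} {N₁ N₂ : Term M} {S T : Ty M} {e e₁ : Eff}
      (h₁ : Typing Γ₁ N₁ (.arrow .right S e T) e₁) (h₂ : Typing Γ₂ N₂ S 0) :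
      Typing (.seq Γ₁ Γ₂) (.app .right N₁ N₂) T (e ⊔ e₁)
  | lapp {Γ₁ Γ₂ : Ctx M} {N₁ N₂ : Term M} {S T : Ty M} {e e₂ : Eff}
      (h₁ : Typing Γ₂ N₁ (.arrow .left S e T) 0) (h₂ : Typing Γ₁ N₂ S e₂) :
      Typing (.seq Γ₁ Γ₂) (.app .left N₁ N₂) T (e ⊔ e₂)
  | upair {Γ₁ Γ₂ : Ctx M} {N₁ N₂ : Term M} {S T : Ty M} {e₁ e₂ : Eff}
      (h₁ : Typing Γ₁ N₁ S e₁) (h₂ : Typing Γ₂ N₂ T e₂) :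
      Typing (.par Γ₁ Γ₂) (.pair .unord N₁ N₂) (.prod .unord S T) (e₁ ⊔ e₂)
  | opair {Γ₁ Γ₂ : Ctx M} {N₁ N₂ : Term M} {S T : Ty M} {e₁ e₂ : Eff}
      (hS : S.Ord → e₂ = 0) (h₁ : Typing Γ₁ N₁ S e₁) (h₂ : Typing Γ₂ N₂ T e₂) :
      Typing (.seq Γ₁ Γ₂) (.pair .ord N₁ N₂) (.prod .ord S T) (e₁ ⊔ e₂)
  | ulet {G : CtxPat M} {Γ : Ctx M} {x y : Var} {N₁ N₂ : Term M} {S₁ S₂ T : Ty M} {e : Eff}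
      (hxy : x ≠ y) (hx : Sum.inl x ∉ (G.fill Γ).dom) (hy : Sum.inl y ∉ (G.fill Γ).dom)
      (h₁ : Typing Γ N₁ (.prod .unord S₁ S₂) 0)
      (h₂ : Typing (G.fill (.par (.var x S₁) (.var y S₂))) N₂ T e) :
      Typing (G.fill Γ) (.letPair .unord x y N₁ N₂) T e
  | olet {G : CtxPat M} {Γ : Ctx M} {x y : Var} {N₁ N₂ : Term M} {S₁ S₂ T : Ty M} {e : Eff}
      (hxy : x ≠ y) (hx : Sum.inl x ∉ (G.fill Γ).dom) (hy : Sum.inl y ∉ (G.fill Γ).dom)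
      (h₁ : Typing Γ N₁ (.prod .ord S₁ S₂) 0)
      (h₂ : Typing (G.fill (.seq (.var x S₁) (.var y S₂))) N₂ T e) :
      Typing (G.fill Γ) (.letPair .ord x y N₁ N₂) T e
  | weaken {Γ₁ Γ₂ : Ctx M} {N : Term M} {T : Ty M} {e₁ e₂ : Eff}
      (h : Typing Γ₁ N T e₁) (hΓ : Γ₂.Sub Γ₁) (he : e₁ ≤ e₂) :
      Typing Γ₂ N T e₂

end OrderedBorrow

namespace OrderedBorrow

universe u

/-- Vertices of run-time contexts. A location may be bound several times, so that its bindings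
carry an identifier. -/
inductive Tok (M : Type u) : Type u
  | var (x : Var) (T : Ty M)
  | loc (i : ℕ) (l : Loc) (m : M)

inductive ConstTyping {M : Type u} [OPM M] : Const M → Ty M → Prop
  | unit : ConstTyping .unit .unit
  | new (m : M) : ConstTyping (.new m) (.arrow .plain .unit 0 (.res m))
  | op (m₀ m₁ m₂ : M) (h : MulLE m₁ m₂ m₀) :
      ConstTyping (.op m₁) (.arrow .plain (.res m₀) 1 (.res m₂))
  | split (m₀ m₁ m₂ : M) (h : MulLE m₁ m₂ m₀) :
      ConstTyping (.split m₁ m₂) (.arrow .plain (.res m₀) 0 (.prod .ord (.res m₁) (.res m₂)))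
  | drop (m : M) (h : OPM.eps ≤ m) : ConstTyping .drop (.arrow .plain (.res m) 0 .unit)

/-- The unrestricted variables in the scope of a binder `x : S`. -/
def bindUnr {M : Type u} (U : Var → Ty M → Prop) (x : Var) (S : Ty M) : Var → Ty M → Prop :=
  fun y T => (y = x ∧ T = S ∧ S.Unr) ∨ (y ≠ x ∧ U y T)

/-- The edges between the vertices `A₁` of the function and `A₂` of the argument that an
application of sort `k` forbids. -/
def FunKind.Sep {M : Type u} (k : FunKind) (R : Tok M → Tok M → Prop) (A₁ A₂ : Set (Tok M)) :
    Prop :=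
  (k ≠ .left → ∀ a ∈ A₁, ∀ b ∈ A₂, ¬ R b a) ∧
    (k = .unord ∨ k = .left → ∀ a ∈ A₁, ∀ b ∈ A₂, ¬ R a b)

def PairKind.Sep {M : Type u} (p : PairKind) (R : Tok M → Tok M → Prop) (A₁ A₂ : Set (Tok M)) :
    Prop :=
  (∀ a ∈ A₁, ∀ b ∈ A₂, ¬ R b a) ∧ (p = .unord → ∀ a ∈ A₁, ∀ b ∈ A₂, ¬ R a b)

/-- Typing with respect to a set `U` of unrestricted variables, a set `A` of ordered bindings and
edges `R` between them. The rules are syntax-directed: weakening is admissible. -/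
inductive RTyping {M : Type u} [OPM M] : (Var → Ty M → Prop) → Set (Tok M) →
    (Tok M → Tok M → Prop) → Term M → Ty M → Eff → Prop
  | const {U A R c T e} (hc : ConstTyping c T) (hA : ∀ a, a ∉ A) : RTyping U A R (.const c) T e
  | uvar {U A R x T e} (hU : U x T) (hA : ∀ a, a ∉ A) : RTyping U A R (.var x) T e
  | ovar {U A R x T e} (hA : ∀ a, a ∈ A ↔ a = .var x T) : RTyping U A R (.var x) T e
  | loc {U A R l m e} (i : ℕ) (hA : ∀ a, a ∈ A ↔ a = .loc i l m) :
      RTyping U A R (.loc l) (.res m) e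
  | lam {U A A' R R' k x N S T e e'}
      (hx : ∀ S', .var x S' ∉ A) (hk : k = .plain → ∀ a, a ∉ A)
      (hA' : ∀ a, a ∈ A' ↔ a ∈ A ∨ (a = .var x S ∧ ¬ S.Unr))
      (hR' : ∀ a ∈ A, ∀ b ∈ A, R a b → R' a b)
      (hright : k = .right → ¬ S.Unr → ∀ a ∈ A, R' a (.var x S))
      (hleft : k = .left → ¬ S.Unr → ∀ a ∈ A, R' (.var x S) a)
      (hN : RTyping (bindUnr U x S) A' R' N T e) :
      RTyping U A R (.lam k x N) (.arrow k S e T) e'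
  | app {U A A₁ A₂ R k N₁ N₂ S T e e₀ e₁ e₂}
      (hA : ∀ a, a ∈ A ↔ a ∈ A₁ ∨ a ∈ A₂) (hd : ∀ a, a ∈ A₁ → a ∉ A₂) (hs : k.Sep R A₁ A₂)
      (hr : k = .right → e₂ = 0) (hl : k = .left → e₁ = 0)
      (h₁ : RTyping U A₁ R N₁ (.arrow k S e₀ T) e₁) (h₂ : RTyping U A₂ R N₂ S e₂)
      (he₀ : e₀ ≤ e) (he₁ : e₁ ≤ e) (he₂ : e₂ ≤ e) : RTyping U A R (.app k N₁ N₂) T e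
  | pair {U A A₁ A₂ R p N₁ N₂ S T e e₁ e₂}
      (hA : ∀ a, a ∈ A ↔ a ∈ A₁ ∨ a ∈ A₂) (hd : ∀ a, a ∈ A₁ → a ∉ A₂) (hs : p.Sep R A₁ A₂)
      (hp : p = .ord → ¬ S.Unr → e₂ = 0)
      (h₁ : RTyping U A₁ R N₁ S e₁) (h₂ : RTyping U A₂ R N₂ T e₂)
      (he₁ : e₁ ≤ e) (he₂ : e₂ ≤ e) : RTyping U A R (.pair p N₁ N₂) (.prod p S T) e
  | letPair {U A A₀ A' R R' p x y N₁ N₂ S₁ S₂ T e}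
      (hxy : x ≠ y) (hx : ∀ S', .var x S' ∉ A) (hy : ∀ S', .var y S' ∉ A)
      (hA₀ : ∀ a, a ∈ A₀ → a ∈ A)
      (hA' : ∀ a, a ∈ A' ↔
        (a ∈ A ∧ a ∉ A₀) ∨ (a = .var x S₁ ∧ ¬ S₁.Unr) ∨ (a = .var y S₂ ∧ ¬ S₂.Unr))
      (hR' : ∀ a ∈ A, a ∉ A₀ → ∀ b ∈ A, b ∉ A₀ → R a b → R' a b)
      (hin₁ : ¬ S₁.Unr → ∀ a ∈ A, a ∉ A₀ → ∀ b ∈ A₀, R a b → R' a (.var x S₁))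
      (hin₂ : ¬ S₂.Unr → ∀ a ∈ A, a ∉ A₀ → ∀ b ∈ A₀, R a b → R' a (.var y S₂))
      (hout₁ : ¬ S₁.Unr → ∀ a ∈ A, a ∉ A₀ → ∀ b ∈ A₀, R b a → R' (.var x S₁) a)
      (hout₂ : ¬ S₂.Unr → ∀ a ∈ A, a ∉ A₀ → ∀ b ∈ A₀, R b a → R' (.var y S₂) a)
      (hord : p = .ord → ¬ S₁.Unr → ¬ S₂.Unr → R' (.var x S₁) (.var y S₂))
      (h₁ : RTyping U A₀ R N₁ (.prod p S₁ S₂) 0)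
      (h₂ : RTyping (bindUnr (bindUnr U x S₁) y S₂) A' R' N₂ T e) :
      RTyping U A R (.letPair p x y N₁ N₂) T e

variable {M : Type u}

theorem bindUnr_mono {U U' : Var → Ty M → Prop} (h : ∀ x T, U x T → U' x T) (x : Var) (S : Ty M) :
    ∀ y T, bindUnr U x S y T → bindUnr U' x S y T := by
  rintro y T (h' | ⟨h₁, h₂⟩)
  · exact .inl h'
  · exact .inr ⟨h₁, h y T h₂⟩

theorem FunKind.Sep.anti {k : FunKind} {R R' : Tok M → Tok M → Prop} {A₁ A₂ A₁' A₂' : Set (Tok M)}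
    (h : k.Sep R A₁ A₂)
    (h₁ : ∀ a ∈ A₁', ∀ b ∈ A₂', R' a b → ∃ a' ∈ A₁, ∃ b' ∈ A₂, R a' b')
    (h₂ : ∀ a ∈ A₁', ∀ b ∈ A₂', R' b a → ∃ a' ∈ A₁, ∃ b' ∈ A₂, R b' a') : k.Sep R' A₁' A₂' := by
  refine ⟨fun hk a ha b hb hR => ?_, fun hk a ha b hb hR => ?_⟩
  · obtain ⟨a', ha', b', hb', h'⟩ := h₂ a ha b hb hR
    exact h.1 hk a' ha' b' hb' h'
  · obtain ⟨a', ha', b', hb', h'⟩ := h₁ a ha b hb hR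
    exact h.2 hk a' ha' b' hb' h'

theorem PairKind.Sep.anti {p : PairKind} {R R' : Tok M → Tok M → Prop} {A₁ A₂ A₁' A₂' : Set (Tok M)}
    (h : p.Sep R A₁ A₂)
    (h₁ : ∀ a ∈ A₁', ∀ b ∈ A₂', R' a b → ∃ a' ∈ A₁, ∃ b' ∈ A₂, R a' b')
    (h₂ : ∀ a ∈ A₁', ∀ b ∈ A₂', R' b a → ∃ a' ∈ A₁, ∃ b' ∈ A₂, R b' a') : p.Sep R' A₁' A₂' := by
  refine ⟨fun a ha b hb hR => ?_, fun hk a ha b hb hR => ?_⟩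
  · obtain ⟨a', ha', b', hb', h'⟩ := h₂ a ha b hb hR
    exact h.1 a' ha' b' hb' h'
  · obtain ⟨a', ha', b', hb', h'⟩ := h₁ a ha b hb hR
    exact h.2 hk a' ha' b' hb' h'

theorem exists_subst_set {α : Type*} (A B : Set α) (v : α) :
    ∃ C : Set α, ∀ a, a ∈ C ↔ (a ∈ A ∧ a ≠ v) ∨ (v ∈ A ∧ a ∈ B) :=
  ⟨{a | (a ∈ A ∧ a ≠ v) ∨ (v ∈ A ∧ a ∈ B)}, fun _ => Iff.rfl⟩

theorem subst_edge {α : Type*} {A A₀ AV A' B₀ : Set α} {R R' Q Q' : α → α → Prop} {w v : α}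
    (hA₀ : ∀ a ∈ A₀, a ∈ A) (hAV : ∀ a ∈ AV, a ∉ A)
    (hA' : ∀ a, a ∈ A' ↔ (a ∈ A ∧ a ≠ w) ∨ (w ∈ A ∧ a ∈ AV))
    (hB₀ : ∀ a, a ∈ B₀ ↔ (a ∈ A₀ ∧ a ≠ w) ∨ (w ∈ A₀ ∧ a ∈ AV))
    (hR : ∀ a ∈ A, a ≠ w → ∀ b ∈ A, b ≠ w → R' a b → R a b)
    (hin : ∀ a ∈ A, a ≠ w → ∀ b ∈ AV, w ∈ A → R' a b → R a w)
    (hout : ∀ a ∈ A, a ≠ w → ∀ b ∈ AV, w ∈ A → R' b a → R w a)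
    (h : ∀ a ∈ A, a ∉ A₀ → ∀ b ∈ A₀, R a b → Q a v)
    (hQ₁ : ∀ a, a ∉ AV → Q a v → Q' a v) (hQ₂ : ∀ a, a ∈ AV → Q w v → Q' a v) :
    ∀ a ∈ A', a ∉ B₀ → ∀ b ∈ B₀, R' a b → Q' a v := by
  intro a ha ha₀ b hb hab
  rw [hB₀] at ha₀ hb
  rcases (hA' a).1 ha with ⟨ha, haw⟩ | ⟨hw, ha⟩
  · have haV : a ∉ AV := fun h => hAV a h ha
    have ha₁ : a ∉ A₀ := fun h => ha₀ (.inl ⟨h, haw⟩)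
    rcases hb with ⟨hb, hbw⟩ | ⟨hw, hb⟩
    · exact hQ₁ a haV (h a ha ha₁ b hb (hR a ha haw b (hA₀ b hb) hbw hab))
    · exact hQ₁ a haV (h a ha ha₁ w hw (hin a ha haw b hb (hA₀ w hw) hab))
  · have hw₀ : w ∉ A₀ := fun h => ha₀ (.inr ⟨h, ha⟩)
    rcases hb with ⟨hb, hbw⟩ | ⟨hw', hb⟩
    · exact hQ₂ a ha (h w hw hw₀ b hb (hout b (hA₀ b hb) hbw a ha hw hab))
    · exact absurd hw' hw₀

def Tok.IsLoc (a : Tok M) : Prop := ∃ i l m, a = .loc i l m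

/-- The edges `R'` between `A \ A₀` and `A₀'` stem from edges between `A \ A₀` and `A₀`. -/
structure Compat (A A₀ A₀' : Set (Tok M)) (R R' : Tok M → Tok M → Prop) : Prop where
  isLoc : ∀ a ∈ A₀', a.IsLoc
  disj : ∀ a ∈ A₀', a ∈ A → a ∈ A₀
  rest : ∀ a ∈ A, a ∉ A₀ → ∀ b ∈ A, b ∉ A₀ → R' a b → R a b
  into : ∀ a ∈ A, a ∉ A₀ → ∀ b ∈ A₀', R' a b → ∃ b' ∈ A₀, R a b'
  out : ∀ a ∈ A, a ∉ A₀ → ∀ b ∈ A₀', R' b a → ∃ b' ∈ A₀, R b' a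

theorem Compat.restrict {A A₀ A₀' B : Set (Tok M)} {R R' : Tok M → Tok M → Prop}
    (h : Compat A A₀ A₀' R R') (hB : ∀ a ∈ B, a ∈ A) : Compat B A₀ A₀' R R' :=
  ⟨h.isLoc, fun a ha ha' => h.disj a ha (hB a ha'),
    fun a ha ha₀ b hb hb₀ => h.rest a (hB a ha) ha₀ b (hB b hb) hb₀,
    fun a ha ha₀ => h.into a (hB a ha) ha₀, fun a ha ha₀ => h.out a (hB a ha) ha₀⟩

/-- The bindings of `l` are those listed in `L`, which are linearly ordered as in `L`. -/
structure CellToks (A : Set (Tok M)) (R : Tok M → Tok M → Prop) (l : Loc) (L : List (ℕ × M)) :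
    Prop where
  nodup : L.Nodup
  mem : ∀ i m, .loc i l m ∈ A ↔ (i, m) ∈ L
  pairwise : L.Pairwise fun p q => R (.loc p.1 l p.2) (.loc q.1 l q.2)

theorem CellToks.frame {A A' : Set (Tok M)} {R R' : Tok M → Tok M → Prop} {l : Loc}
    {L : List (ℕ × M)} (h : CellToks A R l L) (hA : ∀ i m, .loc i l m ∈ A' ↔ .loc i l m ∈ A)
    (hR : ∀ i m j m', R (.loc i l m) (.loc j l m') → R' (.loc i l m) (.loc j l m')) :
    CellToks A' R' l L :=
  ⟨h.nodup, fun i m => (hA i m).trans (h.mem i m), h.pairwise.imp (hR _ _ _ _)⟩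

theorem exists_fresh_id (L : List (ℕ × M)) : ∃ j, ∀ p ∈ L, p.1 < j := by
  induction L with
  | nil => exact ⟨0, by simp⟩
  | cons p L ih =>
    obtain ⟨j, hj⟩ := ih
    exact ⟨max j (p.1 + 1), by grind⟩

/-- A redex: either a redex of expression reduction or an operation applied to a value. -/
def Term.IsRedex (N : Term M) : Prop :=
  (∃ N', BetaStep N N') ∨ (∃ m, N = .app .plain (.const (.new m)) (.const .unit)) ∨
    ∃ c l, N = .app .plain (.const c) (.loc l)

def Term.Reducible (N : Term M) : Prop := ∃ (E : ECtx M) (N₀ : Term M), N = E.fill N₀ ∧ N₀.IsRedex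

def Binding.tok : Binding M → Tok M
  | .var x T => .var x T
  | .loc l m => .loc 0 l m

def Tok.name : Tok M → Var ⊕ Loc
  | .var x _ => Sum.inl x
  | .loc _ l _ => Sum.inr l

theorem Binding.name_tok (b : Binding M) : b.tok.name = b.name := by
  cases b <;> rfl

def Graph.toks (G : Graph M) : Set (Tok M) := {a | ∃ i, (G.label i).tok = a}

def Graph.rel (G : Graph M) (a b : Tok M) : Prop :=
  ∃ i j, G.edge i j ∧ (G.label i).tok = a ∧ (G.label j).tok = b

/-- Distinct vertices of the graph have labels with distinct names. -/
def Graph.Linear (G : Graph M) : Prop := ∀ i j, (G.label i).name = (G.label j).name → i = j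

abbrev Ctx.toks (Γ : Ctx M) : Set (Tok M) := Γ.graph.toks

abbrev Ctx.rel (Γ : Ctx M) : Tok M → Tok M → Prop := Γ.graph.rel

abbrev Ctx.Linear (Γ : Ctx M) : Prop := Γ.graph.Linear

theorem Graph.Iso.spec {G₁ G₂ : Graph M} (h : G₁.Iso G₂) :
    (∀ a, a ∈ G₁.toks ↔ a ∈ G₂.toks) ∧ (∀ a b, G₁.rel a b ↔ G₂.rel a b) ∧
      (G₁.Linear ↔ G₂.Linear) := by
  obtain ⟨f, hf, hl⟩ := h
  refine ⟨fun a => ?_, fun a b => ?_, ?_⟩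
  · simp only [Graph.toks, Set.mem_ofPred_eq]
    rw [f.surjective.exists]
    simp only [hl]
  · simp only [Graph.rel]
    rw [f.surjective.exists]
    simp only [f.surjective.exists, hl, hf]
  · simp only [Graph.Linear]
    rw [f.surjective.forall]
    simp only [f.surjective.forall, hl, f.injective.eq_iff]

theorem Graph.Spanning.spec {G₁ G₂ : Graph M} (h : G₁.Spanning G₂) :
    (∀ a, a ∈ G₁.toks ↔ a ∈ G₂.toks) ∧ (∀ a b, G₁.rel a b → G₂.rel a b) ∧
      (G₁.Linear ↔ G₂.Linear) := by
  cases h with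
  | mk n v E₁ E₂ h =>
    refine ⟨fun a => Iff.rfl, ?_, Iff.rfl⟩
    rintro a b ⟨i, j, hij, ha, hb⟩
    exact ⟨i, j, h i j hij, ha, hb⟩

theorem Ctx.Sub.spec {Γ₁ Γ₂ : Ctx M} (h : Γ₁.Sub Γ₂) :
    (∀ a, a ∈ Γ₁.toks ↔ a ∈ Γ₂.toks) ∧ (∀ a b, Γ₁.rel a b → Γ₂.rel a b) ∧
      (Γ₁.Linear ↔ Γ₂.Linear) := by
  obtain ⟨⟨G₁, G₂, h₁, h₂, h₃⟩, -⟩ := h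
  have h₁ := h₁.spec
  have h₂ := h₂.spec
  have h₃ := h₃.spec
  exact ⟨fun a => (h₁.1 a).trans ((h₂.1 a).trans (h₃.1 a)),
    fun a b h => (h₃.2.1 a b).1 (h₂.2.1 a b ((h₁.2.1 a b).1 h)),
    h₁.2.2.trans (h₂.2.2.trans h₃.2.2)⟩

theorem Graph.rel.mem {G : Graph M} {a b : Tok M} (h : G.rel a b) : a ∈ G.toks ∧ b ∈ G.toks := by
  obtain ⟨i, j, -, rfl, rfl⟩ := h
  exact ⟨⟨i, rfl⟩, ⟨j, rfl⟩⟩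

theorem Graph.Linear.disjoint_sum {G₁ G₂ : Graph M} :
    (∀ i j : Fin (G₁.n + G₂.n), (Sum.elim G₁.label G₂.label (finSumFinEquiv.symm i)).name =
      (Sum.elim G₁.label G₂.label (finSumFinEquiv.symm j)).name → i = j) ↔
    G₁.Linear ∧ G₂.Linear ∧ ∀ a ∈ G₁.toks, ∀ b ∈ G₂.toks, a.name ≠ b.name := by
  rw [finSumFinEquiv.surjective.forall]
  simp only [finSumFinEquiv.surjective.forall, Equiv.symm_apply_apply, Sum.forall, Sum.elim_inl,
    Sum.elim_inr, finSumFinEquiv.injective.eq_iff, Sum.inl.injEq, Sum.inr.injEq, reduceCtorEq,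
    Graph.Linear, Graph.toks, Set.mem_ofPred_eq, forall_exists_index, forall_apply_eq_imp_iff,
    Binding.name_tok]
  constructor
  · rintro ⟨h₁, h₂⟩
    exact ⟨fun i => (h₁ i).1, fun i => (h₂ i).2, fun i j => (h₁ i).2 j⟩
  · rintro ⟨h₁, h₂, h₃⟩
    exact ⟨fun i => ⟨h₁ i, h₃ i⟩, fun i => ⟨fun j h => h₃ j i h.symm, h₂ i⟩⟩

theorem Ctx.linear_seq {Γ₁ Γ₂ : Ctx M} : (Ctx.seq Γ₁ Γ₂).Linear ↔
    Γ₁.Linear ∧ Γ₂.Linear ∧ ∀ a ∈ Γ₁.toks, ∀ b ∈ Γ₂.toks, a.name ≠ b.name :=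
  Graph.Linear.disjoint_sum

theorem Ctx.linear_par {Γ₁ Γ₂ : Ctx M} : (Ctx.par Γ₁ Γ₂).Linear ↔
    Γ₁.Linear ∧ Γ₂.Linear ∧ ∀ a ∈ Γ₁.toks, ∀ b ∈ Γ₂.toks, a.name ≠ b.name :=
  Graph.Linear.disjoint_sum

theorem Ctx.mem_toks_seq {Γ₁ Γ₂ : Ctx M} (a : Tok M) :
    a ∈ (Ctx.seq Γ₁ Γ₂).toks ↔ a ∈ Γ₁.toks ∨ a ∈ Γ₂.toks := by
  simp only [Ctx.graph, Graph.toks, Graph.join, Set.mem_ofPred_eq]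
  rw [finSumFinEquiv.surjective.exists]
  simp

theorem Ctx.mem_toks_par {Γ₁ Γ₂ : Ctx M} (a : Tok M) :
    a ∈ (Ctx.par Γ₁ Γ₂).toks ↔ a ∈ Γ₁.toks ∨ a ∈ Γ₂.toks := by
  simp only [Ctx.graph, Graph.toks, Graph.union, Set.mem_ofPred_eq]
  rw [finSumFinEquiv.surjective.exists]
  simp

theorem Ctx.rel_seq {Γ₁ Γ₂ : Ctx M} (a b : Tok M) :
    (Ctx.seq Γ₁ Γ₂).rel a b ↔ Γ₁.rel a b ∨ Γ₂.rel a b ∨ (a ∈ Γ₁.toks ∧ b ∈ Γ₂.toks) := by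
  simp only [Ctx.graph, Graph.toks, Graph.rel, Graph.join, Set.mem_ofPred_eq]
  rw [finSumFinEquiv.surjective.exists]
  simp only [finSumFinEquiv.surjective.exists, Equiv.symm_apply_apply, Sum.exists, Sum.elim_inl,
    Sum.elim_inr, Sum.lex_inl_inl, Sum.lex_inr_inr, Sum.lex_inr_inl, Sum.Lex.sep]
  grind

theorem Ctx.rel_par {Γ₁ Γ₂ : Ctx M} (a b : Tok M) :
    (Ctx.par Γ₁ Γ₂).rel a b ↔ Γ₁.rel a b ∨ Γ₂.rel a b := by
  simp only [Ctx.graph, Graph.rel, Graph.union]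
  rw [finSumFinEquiv.surjective.exists]
  simp only [finSumFinEquiv.surjective.exists, Equiv.symm_apply_apply, Sum.exists, Sum.elim_inl,
    Sum.elim_inr, Sum.liftRel_inl_inl, Sum.liftRel_inr_inr, Sum.not_liftRel_inr_inl,
    Sum.not_liftRel_inl_inr]
  grind

theorem Ctx.graph_single_of_unr {b : Binding M} (h : b.ty.Unr) :
    (Ctx.single b).graph = ⟨0, Fin.elim0, fun _ _ => False⟩ := if_pos h

theorem Ctx.graph_single_of_not_unr {b : Binding M} (h : ¬ b.ty.Unr) :
    (Ctx.single b).graph = ⟨1, fun _ => b, fun _ _ => False⟩ := if_neg h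

theorem Ctx.mem_toks_single {b : Binding M} (a : Tok M) :
    a ∈ (Ctx.single b).toks ↔ a = b.tok ∧ ¬ b.ty.Unr := by
  by_cases h : b.ty.Unr
  · rw [Ctx.toks, graph_single_of_unr h]
    simp [Graph.toks, h]
  · rw [Ctx.toks, graph_single_of_not_unr h]
    simp [Graph.toks, h, eq_comm]

theorem Ctx.mem_toks_empty (a : Tok M) : a ∉ (Ctx.empty : Ctx M).toks := by
  simp [Ctx.graph, Graph.toks]

theorem Ctx.linear_single (b : Binding M) : (Ctx.single b).Linear := by
  by_cases h : b.ty.Unr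
  · simp only [Ctx.Linear, Ctx.graph, if_pos h]
    exact fun i => i.elim0
  · simp only [Ctx.Linear, Ctx.graph, if_neg h]
    exact fun i j _ => Subsingleton.elim (α := Fin 1) i j

theorem Ctx.name_mem_dom {Γ : Ctx M} {a : Tok M} (h : a ∈ Γ.toks) : a.name ∈ Γ.dom := by
  induction Γ with
  | empty => exact absurd h (mem_toks_empty a)
  | single b =>
    obtain ⟨rfl, -⟩ := (mem_toks_single a).1 h
    exact b.name_tok
  | seq Γ₁ Γ₂ ih₁ ih₂ => exact ((mem_toks_seq a).1 h).imp ih₁ ih₂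
  | par Γ₁ Γ₂ ih₁ ih₂ => exact ((mem_toks_par a).1 h).imp ih₁ ih₂

theorem Ctx.name_mem_dom_of_unr {Γ : Ctx M} {b : Binding M} (h : b ∈ Γ.unrSet) :
    b.name ∈ Γ.dom := by
  induction Γ with
  | empty => exact h
  | single b' =>
    obtain ⟨rfl, -⟩ := h
    rfl
  | seq Γ₁ Γ₂ ih₁ ih₂ => exact h.imp ih₁ ih₂
  | par Γ₁ Γ₂ ih₁ ih₂ => exact h.imp ih₁ ih₂

theorem Ctx.Unr.notMem_toks {Γ : Ctx M} (h : Γ.Unr) (a : Tok M) : a ∉ Γ.toks := by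
  induction Γ with
  | empty => exact mem_toks_empty a
  | single b => exact fun h' => ((mem_toks_single a).1 h').2 h
  | seq Γ₁ Γ₂ ih₁ ih₂ => exact fun h' => ((mem_toks_seq a).1 h').elim (ih₁ h.1) (ih₂ h.2)
  | par Γ₁ Γ₂ ih₁ ih₂ => exact fun h' => ((mem_toks_par a).1 h').elim (ih₁ h.1) (ih₂ h.2)

/-- The interpretation of a context pattern. -/
structure CtxPat.Spec (G : CtxPat M) (B C D : Set (Tok M)) (Q : Tok M → Tok M → Prop)
    (P : Prop) (W : Set (Binding M)) : Prop where
  before : ∀ a ∈ B, a ∈ D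
  after : ∀ a ∈ C, a ∈ D
  relMem : ∀ a b, Q a b → a ∈ D ∧ b ∈ D
  toks : ∀ Δ a, a ∈ (G.fill Δ).toks ↔ a ∈ D ∨ a ∈ Δ.toks
  rel : ∀ Δ a b, (G.fill Δ).rel a b ↔
    Q a b ∨ Δ.rel a b ∨ (a ∈ B ∧ b ∈ Δ.toks) ∨ (a ∈ Δ.toks ∧ b ∈ C)
  linear : ∀ Δ, (G.fill Δ).Linear ↔
    P ∧ Δ.Linear ∧ ∀ a ∈ D, ∀ b ∈ Δ.toks, a.name ≠ b.name
  unrSet : ∀ Δ, (G.fill Δ).unrSet = W ∪ Δ.unrSet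

theorem CtxPat.exists_spec (G : CtxPat M) : ∃ B C D Q P W, G.Spec B C D Q P W := by
  induction G with
  | hole =>
    refine ⟨∅, ∅, ∅, fun _ _ => False, True, ∅, ?_, ?_, ?_, ?_, ?_, ?_, ?_⟩ <;>
      simp [CtxPat.fill]
  | seqRight Γ G ih =>
    obtain ⟨B, C, D, Q, P, W, h₁, h₂, h₃, h₄, h₅, h₆, h₇⟩ := ih
    refine ⟨{a | a ∈ Γ.toks ∨ a ∈ B}, C, {a | a ∈ Γ.toks ∨ a ∈ D},
      fun a b => Γ.rel a b ∨ Q a b ∨ (a ∈ Γ.toks ∧ b ∈ D),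
      Γ.Linear ∧ P ∧ ∀ a ∈ Γ.toks, ∀ b ∈ D, a.name ≠ b.name, Γ.unrSet ∪ W, ?_, ?_, ?_, ?_, ?_, ?_, ?_⟩ <;>
    simp only [CtxPat.fill, Set.mem_ofPred_eq, Ctx.mem_toks_seq, Ctx.rel_seq, Ctx.linear_seq, h₄, h₅, h₆,
      Ctx.unrSet, h₇, Set.union_assoc]
    · grind
    · grind
    · have := @Graph.rel.mem M Γ.graph
      grind
    · grind
    · grind
    · grind
    · simp
  | seqLeft G Γ ih =>
    obtain ⟨B, C, D, Q, P, W, h₁, h₂, h₃, h₄, h₅, h₆, h₇⟩ := ih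
    refine ⟨B, {a | a ∈ Γ.toks ∨ a ∈ C}, {a | a ∈ Γ.toks ∨ a ∈ D},
      fun a b => Γ.rel a b ∨ Q a b ∨ (a ∈ D ∧ b ∈ Γ.toks),
      Γ.Linear ∧ P ∧ ∀ a ∈ Γ.toks, ∀ b ∈ D, a.name ≠ b.name, W ∪ Γ.unrSet, ?_, ?_, ?_, ?_, ?_, ?_, ?_⟩ <;>
    simp only [CtxPat.fill, Set.mem_ofPred_eq, Ctx.mem_toks_seq, Ctx.rel_seq, Ctx.linear_seq, h₄, h₅, h₆,
      Ctx.unrSet, h₇, Set.union_assoc]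
    · grind
    · grind
    · have := @Graph.rel.mem M Γ.graph
      grind
    · grind
    · grind
    · grind
    · simp [Set.union_comm]
  | parRight Γ G ih =>
    obtain ⟨B, C, D, Q, P, W, h₁, h₂, h₃, h₄, h₅, h₆, h₇⟩ := ih
    refine ⟨B, C, {a | a ∈ Γ.toks ∨ a ∈ D}, fun a b => Γ.rel a b ∨ Q a b,
      Γ.Linear ∧ P ∧ ∀ a ∈ Γ.toks, ∀ b ∈ D, a.name ≠ b.name, Γ.unrSet ∪ W, ?_, ?_, ?_, ?_, ?_, ?_, ?_⟩ <;>
    simp only [CtxPat.fill, Set.mem_ofPred_eq, Ctx.mem_toks_par, Ctx.rel_par, Ctx.linear_par, h₄, h₅, h₆,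
      Ctx.unrSet, h₇, Set.union_assoc]
    · grind
    · grind
    · have := @Graph.rel.mem M Γ.graph
      grind
    · grind
    · grind
    · grind
    · simp
  | parLeft G Γ ih =>
    obtain ⟨B, C, D, Q, P, W, h₁, h₂, h₃, h₄, h₅, h₆, h₇⟩ := ih
    refine ⟨B, C, {a | a ∈ Γ.toks ∨ a ∈ D}, fun a b => Γ.rel a b ∨ Q a b,
      Γ.Linear ∧ P ∧ ∀ a ∈ Γ.toks, ∀ b ∈ D, a.name ≠ b.name, W ∪ Γ.unrSet, ?_, ?_, ?_, ?_, ?_, ?_, ?_⟩ <;>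
    simp only [CtxPat.fill, Set.mem_ofPred_eq, Ctx.mem_toks_par, Ctx.rel_par, Ctx.linear_par, h₄, h₅, h₆,
      Ctx.unrSet, h₇, Set.union_assoc]
    · grind
    · grind
    · have := @Graph.rel.mem M Γ.graph
      grind
    · grind
    · grind
    · grind
    · simp [Set.union_comm]

def PairKind.ctx (p : PairKind) (Γ₁ Γ₂ : Ctx M) : Ctx M :=
  match p with
  | .unord => .par Γ₁ Γ₂
  | .ord => .seq Γ₁ Γ₂

theorem Ctx.rel_seq_restrict {Γ₁ Γ₂ : Ctx M} (h : (Ctx.seq Γ₁ Γ₂).Linear) :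
    (∀ a ∈ Γ₁.toks, ∀ b ∈ Γ₁.toks, (Ctx.seq Γ₁ Γ₂).rel a b → Γ₁.rel a b) ∧
    (∀ a ∈ Γ₂.toks, ∀ b ∈ Γ₂.toks, (Ctx.seq Γ₁ Γ₂).rel a b → Γ₂.rel a b) ∧
    (∀ a ∈ Γ₁.toks, ∀ b ∈ Γ₂.toks, ¬ (Ctx.seq Γ₁ Γ₂).rel b a) ∧ ∀ a ∈ Γ₁.toks, a ∉ Γ₂.toks := by
  have hd : ∀ a ∈ Γ₁.toks, a ∉ Γ₂.toks := fun a ha ha' => (linear_seq.1 h).2.2 a ha a ha' rfl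
  have h₁ : ∀ a b, Γ₁.rel a b → a ∈ Γ₁.toks ∧ b ∈ Γ₁.toks := fun a b => Graph.rel.mem
  have h₂ : ∀ a b, Γ₂.rel a b → a ∈ Γ₂.toks ∧ b ∈ Γ₂.toks := fun a b => Graph.rel.mem
  simp only [rel_seq]
  grind

theorem Ctx.rel_par_restrict {Γ₁ Γ₂ : Ctx M} (h : (Ctx.par Γ₁ Γ₂).Linear) :
    (∀ a ∈ Γ₁.toks, ∀ b ∈ Γ₁.toks, (Ctx.par Γ₁ Γ₂).rel a b → Γ₁.rel a b) ∧
    (∀ a ∈ Γ₂.toks, ∀ b ∈ Γ₂.toks, (Ctx.par Γ₁ Γ₂).rel a b → Γ₂.rel a b) ∧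
    (∀ a ∈ Γ₁.toks, ∀ b ∈ Γ₂.toks, ¬ (Ctx.par Γ₁ Γ₂).rel b a ∧ ¬ (Ctx.par Γ₁ Γ₂).rel a b) ∧
    ∀ a ∈ Γ₁.toks, a ∉ Γ₂.toks := by
  have hd : ∀ a ∈ Γ₁.toks, a ∉ Γ₂.toks := fun a ha ha' => (linear_par.1 h).2.2 a ha a ha' rfl
  have h₁ : ∀ a b, Γ₁.rel a b → a ∈ Γ₁.toks ∧ b ∈ Γ₁.toks := fun a b => Graph.rel.mem
  have h₂ : ∀ a b, Γ₂.rel a b → a ∈ Γ₂.toks ∧ b ∈ Γ₂.toks := fun a b => Graph.rel.mem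
  simp only [rel_par]
  grind

variable [OPM M]

/-- Weakening: fewer edges, more unrestricted variables, a larger effect. -/
theorem RTyping.weaken {U U' : Var → Ty M → Prop} {A : Set (Tok M)} {R R' : Tok M → Tok M → Prop}
    {N : Term M} {T : Ty M} {e e' : Eff} (h : RTyping U A R N T e)
    (hU : ∀ x T, U x T → U' x T) (hR : ∀ a ∈ A, ∀ b ∈ A, R' a b → R a b) (he : e ≤ e') :
    RTyping U' A R' N T e' := by
  induction h generalizing U' R' e' with
  | const hc hA => exact .const hc hA
  | uvar h hA => exact .uvar (hU _ _ h) hA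
  | ovar hA => exact .ovar hA
  | loc i hA => exact .loc i hA
  | lam hx hk hA' hR' hright hleft hN ih =>
    exact .lam hx hk hA' (fun a ha b hb h => hR' a ha b hb (hR a ha b hb h)) hright hleft
      (ih (bindUnr_mono hU _ _) (fun _ _ _ _ h => h) le_rfl)
  | app hA hd hs hr hl h₁ h₂ he₀ he₁ he₂ ih₁ ih₂ =>
    refine .app hA hd (hs.anti ?_ ?_) hr hl (ih₁ hU ?_ le_rfl) (ih₂ hU ?_ le_rfl)
      (he₀.trans he) (he₁.trans he) (he₂.trans he) <;> grind
  | pair hA hd hs hp h₁ h₂ he₁ he₂ ih₁ ih₂ =>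
    refine .pair hA hd (hs.anti ?_ ?_) hp (ih₁ hU ?_ le_rfl) (ih₂ hU ?_ le_rfl)
      (he₁.trans he) (he₂.trans he) <;> grind
  | letPair hxy hx hy hA₀ hA' hR' hin₁ hin₂ hout₁ hout₂ hord h₁ h₂ ih₁ ih₂ =>
    refine .letPair hxy hx hy hA₀ hA' ?_ ?_ ?_ ?_ ?_ hord (ih₁ hU ?_ le_rfl)
      (ih₂ (bindUnr_mono (bindUnr_mono hU _ _) _ _) (fun _ _ _ _ h => h) he) <;> grind

theorem RTyping.congr {U : Var → Ty M → Prop} {A A' : Set (Tok M)} {R : Tok M → Tok M → Prop}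
    {N : Term M} {T : Ty M} {e : Eff} (h : RTyping U A R N T e)
    (hA : ∀ a, a ∈ A' ↔ a ∈ A) : RTyping U A' R N T e := by
  rwa [show A' = A from Set.ext hA]

theorem RTyping.value_eff {U : Var → Ty M → Prop} {A : Set (Tok M)} {R : Tok M → Tok M → Prop}
    {V : Term M} {T : Ty M} {e : Eff} (h : RTyping U A R V T e) (hV : V.IsValue) (e' : Eff) :
    RTyping U A R V T e' := by
  induction h generalizing e' with
  | const hc hA => exact .const hc hA
  | uvar | ovar | app | letPair => cases hV
  | loc i hA => exact .loc i hA
  | lam hx hk hA' hR' hright hleft hN => exact .lam hx hk hA' hR' hright hleft hN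
  | pair hA hd hs hp h₁ h₂ he₁ he₂ ih₁ ih₂ =>
    cases hV with
    | pair _ hV₁ hV₂ =>
      exact .pair hA hd hs (fun _ _ => rfl) (ih₁ hV₁ 0) (ih₂ hV₂ 0) (Fin.zero_le _) (Fin.zero_le _)

theorem RTyping.value_unr {U : Var → Ty M → Prop} {A : Set (Tok M)} {R : Tok M → Tok M → Prop}
    {V : Term M} {T : Ty M} {e : Eff} (h : RTyping U A R V T e) (hV : V.IsValue) (hT : T.Unr) :
    ∀ a, a ∉ A := by
  induction h with
  | const hc hA => exact hA
  | uvar | ovar | app | letPair => cases hV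
  | loc i hA => cases hT
  | lam hx hk => cases hT; exact hk rfl
  | pair hA hd hs hp h₁ h₂ he₁ he₂ ih₁ ih₂ =>
    cases hV with
    | pair _ hV₁ hV₂ =>
      cases hT with
      | prod _ hS hT => intro a ha; exact ((hA a).1 ha).elim (ih₁ hV₁ hS a) (ih₂ hV₂ hT a)

set_option maxHeartbeats 1000000 in
/-- Substitution of a closed value. The vertices `AV` of the value replace the vertex `x : S`. -/
theorem RTyping.subst {U U' : Var → Ty M → Prop} {A A' AV : Set (Tok M)}
    {R R' : Tok M → Tok M → Prop} {N V : Term M} {x : Var} {S T : Ty M} {e : Eff}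
    (h : RTyping U A R N T e) (hV : RTyping (fun _ _ => False) AV R' V S 0)
    (hAV : ∀ a ∈ AV, (∃ i l m, a = .loc i l m) ∧ a ∉ A)
    (hxA : ∀ S', .var x S' ∈ A → S' = S)
    (hxU : ∀ S', U x S' → S' = S ∧ ∀ a, a ∉ AV)
    (hU' : ∀ y T, y ≠ x → U y T → U' y T)
    (hA' : ∀ a, a ∈ A' ↔ (a ∈ A ∧ a ≠ .var x S) ∨ (.var x S ∈ A ∧ a ∈ AV))
    (hR : ∀ a ∈ A, a ≠ .var x S → ∀ b ∈ A, b ≠ .var x S → R' a b → R a b)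
    (hin : ∀ a ∈ A, a ≠ .var x S → ∀ b ∈ AV, .var x S ∈ A → R' a b → R a (.var x S))
    (hout : ∀ a ∈ A, a ≠ .var x S → ∀ b ∈ AV, .var x S ∈ A → R' b a → R (.var x S) a) :
    RTyping U' A' R' (N.subst x V) T e := by
  induction h generalizing U' A' R' with
  | const hc hA => exact .const hc (by grind)
  | @uvar U A R y T e h hA =>
    by_cases hy : y = x
    · subst hy
      obtain ⟨rfl, h'⟩ := hxU _ h
      simp only [Term.subst, if_true]
      exact (hV.weaken (by simp) (fun _ _ _ _ h => h) (Fin.zero_le _)).congr (by grind)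
    · simp only [Term.subst, if_neg hy]
      exact .uvar (hU' _ _ hy h) (by grind)
  | @ovar U A R y T e hA =>
    by_cases hy : y = x
    · subst hy
      obtain rfl := hxA T ((hA _).2 rfl)
      simp only [Term.subst, if_true]
      exact (hV.weaken (by simp) (fun _ _ _ _ h => h) (Fin.zero_le _)).congr (by grind)
    · simp only [Term.subst, if_neg hy]
      exact .ovar (by grind)
  | loc i hA => exact .loc i (by grind)
  | @lam U A B R Q k y N S₀ T e e' hy hk hB hQ hright hleft hN ih =>
    simp only [Term.subst]
    by_cases hyx : y = x
    · subst hyx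
      rw [if_pos rfl]
      have hAA : ∀ a, a ∈ A' ↔ a ∈ A := by grind
      refine .lam (by grind) (by grind) (by grind) ?_ (by grind) (by grind)
        (hN.weaken ?_ (fun _ _ _ _ h => h) le_rfl)
      · intro a ha b hb h
        exact hQ a ((hAA a).1 ha) b ((hAA b).1 hb) (by grind)
      · rintro z T' (h | ⟨h₁, h₂⟩)
        exacts [.inl h, .inr ⟨h₁, hU' _ _ h₁ h₂⟩]
    · rw [if_neg hyx]
      have hne : ∀ S', Tok.var y S' ≠ Tok.var x S := by simp [hyx]
      have hyV : ∀ S', Tok.var y S' ∉ AV := fun S' h => by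
        obtain ⟨⟨i, l, m, h⟩, -⟩ := hAV _ h
        cases h
      refine .lam (A' := fun a => a ∈ A' ∨ (a = .var y S₀ ∧ ¬ S₀.Unr))
        (R' := fun a b => (a ∈ A' ∧ b ∈ A' ∧ R' a b) ∨
          (k = .right ∧ a ∈ A' ∧ b = .var y S₀) ∨ (k = .left ∧ b ∈ A' ∧ a = .var y S₀))
        (by grind) ?_ (fun _ => Iff.rfl) (by grind) (by grind) (by grind)
        (ih (hV.weaken (by simp) ?_ le_rfl) ?_ ?_ ?_ ?_ ?_ ?_ ?_ ?_)
      · intro hk' a ha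
        have := hk hk'
        grind
      · grind
      · grind
      · grind
      · rintro S' (h | h) <;> grind
      · rintro z T' hz (h | h)
        exacts [.inl h, .inr ⟨h.1, hU' _ _ hz h.2⟩]
      · intro a
        change (a ∈ A' ∨ (a = .var y S₀ ∧ ¬ S₀.Unr)) ↔ _
        grind
      · grind
      · grind
      · grind
  | @app U A A₁ A₂ R k N₁ N₂ S₀ T e e₀ e₁ e₂ hA hd hs hr hl h₁ h₂ he₀ he₁ he₂ ih₁ ih₂ =>
    obtain ⟨B₁, hB₁⟩ := exists_subst_set A₁ AV (.var x S)
    obtain ⟨B₂, hB₂⟩ := exists_subst_set A₂ AV (.var x S)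
    replace ih₁ := ih₁ hV (by grind) (by grind) hxU hU' hB₁ (by grind) (by grind) (by grind)
    replace ih₂ := ih₂ hV (by grind) (by grind) hxU hU' hB₂ (by grind) (by grind) (by grind)
    refine .app (by grind) (by grind) (hs.anti ?_ ?_) hr hl ih₁ ih₂ he₀ he₁ he₂ <;>
    clear ih₁ ih₂ hV h₁ h₂ hxU hU' <;> grind
  | @pair U A A₁ A₂ R p N₁ N₂ S₀ T e e₁ e₂ hA hd hs hp h₁ h₂ he₁ he₂ ih₁ ih₂ =>
    obtain ⟨B₁, hB₁⟩ := exists_subst_set A₁ AV (.var x S)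
    obtain ⟨B₂, hB₂⟩ := exists_subst_set A₂ AV (.var x S)
    replace ih₁ := ih₁ hV (by grind) (by grind) hxU hU' hB₁ (by grind) (by grind) (by grind)
    replace ih₂ := ih₂ hV (by grind) (by grind) hxU hU' hB₂ (by grind) (by grind) (by grind)
    refine .pair (by grind) (by grind) (hs.anti ?_ ?_) hp ih₁ ih₂ he₁ he₂ <;>
    clear ih₁ ih₂ hV h₁ h₂ hxU hU' <;> grind
  | @letPair U A A₀ B R Q p y z N₁ N₂ S₁ S₂ T e hyz hy hz hA₀ hB hQ hin₁ hin₂ hout₁ hout₂ hord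
      h₁ h₂ ih₁ ih₂ =>
    obtain ⟨B₀, hB₀⟩ := exists_subst_set A₀ AV (.var x S)
    replace ih₁ := ih₁ hV (by grind) (by grind) hxU hU' hB₀ (by grind) (by grind) (by grind)
    simp only [Term.subst]
    have hVl : ∀ y S', Tok.var y S' ∉ AV := fun y S' h => by
      obtain ⟨⟨i, l, m, h⟩, -⟩ := hAV _ h
      cases h
    by_cases hyx : y = x ∨ z = x
    · rw [if_pos hyx]
      have hxA' : .var x S ∉ A := by grind
      have hAA : ∀ a, a ∈ A' ↔ a ∈ A := by grind
      refine .letPair (A' := B) hyz (by grind) (by grind) (by grind) (by grind) ?_ ?_ ?_ ?_ ?_ hord ih₁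
        (h₂.weaken ?_ (fun _ _ _ _ h => h) le_rfl)
      · clear ih₁ ih₂ hV h₁ h₂ hxU hU'
        grind
      · clear ih₁ ih₂ hV h₁ h₂ hxU hU'
        grind
      · clear ih₁ ih₂ hV h₁ h₂ hxU hU'
        grind
      · clear ih₁ ih₂ hV h₁ h₂ hxU hU'
        grind
      · clear ih₁ ih₂ hV h₁ h₂ hxU hU'
        grind
      rintro v T' (h | ⟨h, h' | h'⟩)
      · exact .inl h
      · exact .inr ⟨h, .inl h'⟩
      · exact .inr ⟨h, .inr ⟨h'.1, hU' _ _ (by grind) h'.2⟩⟩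
    · rw [if_neg hyx]
      have hne₁ : ∀ S', Tok.var y S' ≠ Tok.var x S := by grind
      have hne₂ : ∀ S', Tok.var z S' ≠ Tok.var x S := by grind
      obtain ⟨B', hB'⟩ := exists_subst_set B AV (.var x S)
      -- a vertex of the new context stands for a vertex of the old one
      obtain ⟨Q', hQ'⟩ : ∃ Q' : Tok M → Tok M → Prop, ∀ a b, Q' a b ↔
          (a ∈ AV ∧ b ∈ AV ∧ R' a b) ∨ (a ∉ AV ∧ b ∉ AV ∧ Q a b) ∨
          (a ∈ AV ∧ b ∉ AV ∧ Q (.var x S) b) ∨ (a ∉ AV ∧ b ∈ AV ∧ Q a (.var x S)) :=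
        ⟨_, fun _ _ => Iff.rfl⟩
      replace ih₂ := ih₂ (U' := bindUnr (bindUnr U' y S₁) z S₂) (A' := B') (R' := Q')
        (hV.weaken (by simp) (by grind) le_rfl) (by grind) (by grind)
        (by rintro S' (h | ⟨-, h | h⟩) <;> grind)
        (by
          rintro v T' hv (h | ⟨h, h' | h'⟩)
          · exact .inl h
          · exact .inr ⟨h, .inl h'⟩
          · exact .inr ⟨h, .inr ⟨h'.1, hU' _ _ hv h'.2⟩⟩) hB' (by grind) (by grind) (by grind)
      have hAVA : ∀ a ∈ AV, a ∉ A := fun a ha => (hAV a ha).2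
      have hQ₁ : ∀ v ∉ AV, ∀ a, (a ∉ AV → Q a v → Q' a v) ∧ (a ∈ AV → Q (.var x S) v → Q' a v) ∧
          (a ∉ AV → Q v a → Q' v a) ∧ (a ∈ AV → Q v (.var x S) → Q' v a) := by
        intro v hv a
        simp only [hQ']
        exact ⟨fun h h' => .inr (.inl ⟨h, hv, h'⟩), fun h h' => .inr (.inr (.inl ⟨h, hv, h'⟩)),
          fun h h' => .inr (.inl ⟨hv, h, h'⟩), fun h h' => .inr (.inr (.inr ⟨hv, h, h'⟩))⟩
      refine .letPair (A' := B') hyz (by grind) (by grind) (by grind) ?_ ?_ ?_ ?_ ?_ ?_ ?_ ih₁ ih₂ <;>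
      clear ih₁ ih₂ hV h₁ h₂ hxU hU'
      · grind
      · grind
      · exact fun hS => subst_edge hA₀ hAVA hA' hB₀ hR hin hout (hin₁ hS)
          (fun a h => (hQ₁ _ (hVl y S₁) a).1 h) (fun a h => (hQ₁ _ (hVl y S₁) a).2.1 h)
      · exact fun hS => subst_edge hA₀ hAVA hA' hB₀ hR hin hout (hin₂ hS)
          (fun a h => (hQ₁ _ (hVl z S₂) a).1 h) (fun a h => (hQ₁ _ (hVl z S₂) a).2.1 h)
      · exact fun hS => subst_edge (R := flip R) (R' := flip R') (Q := flip Q) (Q' := flip Q')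
          hA₀ hAVA hA' hB₀ (fun a h₁ h₂ b h₃ h₄ => hR b h₃ h₄ a h₁ h₂) hout hin (hout₁ hS)
          (fun a h => (hQ₁ _ (hVl y S₁) a).2.2.1 h) (fun a h => (hQ₁ _ (hVl y S₁) a).2.2.2 h)
      · exact fun hS => subst_edge (R := flip R) (R' := flip R') (Q := flip Q) (Q' := flip Q')
          hA₀ hAVA hA' hB₀ (fun a h₁ h₂ b h₃ h₄ => hR b h₃ h₄ a h₁ h₂) hout hin (hout₂ hS)
          (fun a h => (hQ₁ _ (hVl z S₂) a).2.2.1 h) (fun a h => (hQ₁ _ (hVl z S₂) a).2.2.2 h)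
      · exact fun hp hS₁ hS₂ => (hQ₁ _ (hVl z S₂) _).1 (hVl y S₁) (hord hp hS₁ hS₂)

/-- Typing of terms without free variables. -/
abbrev CTyping (A : Set (Tok M)) (R : Tok M → Tok M → Prop) (N : Term M) (T : Ty M) (e : Eff) :
    Prop :=
  RTyping (fun _ _ => False) A R N T e

theorem CTyping.beta {A : Set (Tok M)} {R : Tok M → Tok M → Prop} {N N' : Term M} {T : Ty M}
    {e : Eff} (h : CTyping A R N T e) (hA : ∀ a ∈ A, a.IsLoc) (hN : BetaStep N N') :
    CTyping A R N' T e := by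
  have hvar : ∀ x S, Tok.var x S ∉ A := fun x S h => by
    obtain ⟨i, l, m, h⟩ := hA _ h
    cases h
  cases hN with
  | beta k x N V hV =>
    cases h with
    | @app _ _ A₁ A₂ _ _ _ _ S _ _ e₀ e₁ e₂ hAA hd hs hr hl h₁ h₂ he₀ he₁ he₂ =>
      cases h₁ with
      | @lam _ _ A' _ R' _ _ _ _ _ _ _ hx hk hA' hR' hright hleft hN =>
        have hV' := h₂.value_unr hV
        refine (hN.subst (S := S) (U' := fun _ _ => False) (A' := A) (h₂.value_eff hV 0)
          (by grind [Tok.IsLoc]) (by grind) ?_ ?_ (by grind) (by grind) ?_ ?_).weaken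
          (fun _ _ h => h) (fun _ _ _ _ h => h) he₀
        · rintro S' (⟨-, h, h'⟩ | h)
          · exact ⟨h, hV' h'⟩
          · exact absurd rfl h.1
        · rintro y T' hy (h | h)
          · exact absurd h.1 hy
          · exact h.2
        · intro a ha hax b hb hxA hR
          have hS : ¬ S.Unr := fun h => hV' h b hb
          have haA : a ∈ A₁ := by grind
          cases k with
          | plain => exact absurd haA (hk rfl a)
          | unord => exact absurd hR (hs.2 (.inl rfl) a haA b hb)
          | right => exact hright rfl hS a haA
          | left => exact absurd hR (hs.2 (.inr rfl) a haA b hb)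
        · intro a ha hax b hb hxA hR
          have hS : ¬ S.Unr := fun h => hV' h b hb
          have haA : a ∈ A₁ := by grind
          cases k with
          | plain => exact absurd haA (hk rfl a)
          | unord => exact absurd hR (hs.1 (by simp) a haA b hb)
          | right => exact absurd hR (hs.1 (by simp) a haA b hb)
          | left => exact hleft rfl hS a haA
  | letPair p x y V₁ V₂ N hxy hV₁ hV₂ =>
    cases h with
    | @letPair _ _ A₀ A' _ R' _ _ _ _ _ S₁ S₂ _ _ _ hx hy hA₀ hA' hR' hin₁ hin₂ hout₁ hout₂ hord
        h₁ h₂ =>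
      cases h₁ with
      | @pair _ _ A₁ A₂ _ _ _ _ _ _ _ e₁ e₂ hAA hd hs hp h₁ h₁' he₁ he₂ =>
        have hu₁ := h₁.value_unr hV₁
        have hu₂ := h₁'.value_unr hV₂
        obtain ⟨Q, hQ⟩ : ∃ Q : Tok M → Tok M → Prop, ∀ a b, Q a b ↔
            (a ∈ A₁ ∧ b ∈ A₁ ∧ R a b) ∨ (a ∉ A₁ ∧ b ∉ A₁ ∧ R' a b) ∨
            (a ∈ A₁ ∧ b ∉ A₁ ∧ R' (.var x S₁) b) ∨ (a ∉ A₁ ∧ b ∈ A₁ ∧ R' a (.var x S₁)) :=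
          ⟨_, fun _ _ => Iff.rfl⟩
        obtain ⟨B, hB⟩ := exists_subst_set A' A₁ (.var x S₁)
        have hAl : ∀ a ∈ A, ∃ i l m, a = Tok.loc i l m := hA
        refine (h₂.subst (S := S₁) (U' := bindUnr (fun _ _ => False) y S₂) (R' := Q) (A' := B)
          ((h₁.value_eff hV₁ 0).weaken (fun _ _ h => h) (by grind) le_rfl)
          (by grind) (by grind) ?_ ?_ hB (by grind) (by grind) (by grind)).subst (S := S₂)
          (h₁'.value_eff hV₂ 0) (by grind) (by grind) ?_ ?_ (by grind) ?_ ?_ ?_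
        · rintro S' (h | ⟨-, ⟨-, h, h'⟩ | h⟩)
          · exact absurd h.1 hxy
          · exact ⟨h, hu₁ h'⟩
          · exact absurd rfl h.1
        · rintro z T' hz (h | ⟨h, h' | h'⟩)
          · exact .inl h
          · exact absurd h'.1 hz
          · exact h'.2.elim
        · rintro S' (⟨-, h, h'⟩ | h)
          · exact ⟨h, hu₂ h'⟩
          · exact absurd rfl h.1
        · rintro z T' hz (h | h)
          · exact absurd h.1 hz
          · exact h.2
        · clear hp h₁ h₁' h₂
          grind
        · intro a ha hay b hb hyB hR
          have hS : ¬ S₂.Unr := fun h => hu₂ h b hb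
          by_cases ha₁ : a ∈ A₁
          · have hS₁ : ¬ S₁.Unr := fun h => hu₁ h a ha₁
            cases p with
            | unord => exact absurd hR (hs.2 rfl a ha₁ b hb)
            | ord => exact (hQ _ _).2 (.inr (.inr (.inl ⟨ha₁, by grind, hord rfl hS₁ hS⟩)))
          · refine (hQ _ _).2 (.inr (.inl ⟨ha₁, by grind, hin₂ hS a ?_ ?_ b ?_ hR⟩)) <;>
            clear hp h₁ h₁' h₂ <;> grind
        · intro a ha hay b hb hyB hR
          have hS : ¬ S₂.Unr := fun h => hu₂ h b hb
          by_cases ha₁ : a ∈ A₁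
          · exact absurd hR (hs.1 a ha₁ b hb)
          · refine (hQ _ _).2 (.inr (.inl ⟨by grind, ha₁, hout₂ hS a ?_ ?_ b ?_ hR⟩)) <;>
            clear hp h₁ h₁' h₂ <;> grind

/-- The term in the hole of an evaluation context is well-typed and may be replaced; its bindings
have no predecessors if it may perform operations. -/
theorem CTyping.fill {A : Set (Tok M)} {R : Tok M → Tok M → Prop} {N : Term M} {T : Ty M} {e : Eff}
    (E : ECtx M) (h : CTyping A R (E.fill N) T e) (hA : ∀ a ∈ A, a.IsLoc) :
    ∃ A₀ S e₀, (∀ a ∈ A₀, a ∈ A) ∧ CTyping A₀ R N S e₀ ∧ e₀ ≤ e ∧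
      (e₀ ≠ 0 → ∀ a ∈ A, a ∉ A₀ → ∀ b ∈ A₀, ¬ R a b) ∧
      ∀ N' A₀' R' A', CTyping A₀' R' N' S e₀ → Compat A A₀ A₀' R R' →
        (∀ a, a ∈ A' ↔ (a ∈ A ∧ a ∉ A₀) ∨ a ∈ A₀') → CTyping A' R' (E.fill N') T e := by
  induction E generalizing A T e with
  | hole =>
    exact ⟨A, T, e, fun _ h => h, h, le_rfl, fun _ _ h h' => absurd h h',
      fun N' A₀' R' A' h' hc hA' => h'.congr (by grind)⟩
  | appFun k hk E N₂ ih =>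
    cases h with
    | @app _ _ A₁ A₂ _ _ _ _ S _ _ e' e₁ e₂ hAA hd hs hr hl h₁ h₂ he₀ he₁ he₂ =>
      obtain ⟨A₀, S₀, e₀, h₀, hN, he, hmin, hrep⟩ := ih h₁ (by grind)
      refine ⟨A₀, S₀, e₀, by grind, hN, he.trans he₁, ?_, ?_⟩
      · intro he' a ha ha₀ b hb hab
        rcases (hAA a).1 ha with ha | ha
        · exact hmin he' a ha ha₀ b hb hab
        · exact hs.1 hk b (h₀ b hb) a ha hab
      · intro N' A₀' R' A' hN' hc hA'
        obtain ⟨B, hB⟩ : ∃ B : Set (Tok M), ∀ a, a ∈ B ↔ (a ∈ A₁ ∧ a ∉ A₀) ∨ a ∈ A₀' :=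
          ⟨_, fun _ => Iff.rfl⟩
        have h₁' := hrep N' A₀' R' B hN' (hc.restrict (by grind)) hB
        obtain ⟨hc₁, hc₂, hc₃, hc₄, hc₅⟩ := hc
        exact .app (by grind) (by grind) (hs.anti (by grind) (by grind)) hr hl h₁'
          (h₂.weaken (fun _ _ h => h) (by grind) le_rfl) he₀ he₁ he₂
  | appArg k hk V hV E ih =>
    cases h with
    | @app _ _ A₁ A₂ _ _ _ _ S _ _ e' e₁ e₂ hAA hd hs hr hl h₁ h₂ he₀ he₁ he₂ =>
      obtain ⟨A₀, S₀, e₀, h₀, hN, he, hmin, hrep⟩ := ih h₂ (by grind)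
      refine ⟨A₀, S₀, e₀, by grind, hN, he.trans he₂, ?_, ?_⟩
      · intro he' a ha ha₀ b hb hab
        rcases (hAA a).1 ha with ha | ha
        swap
        · exact hmin he' a ha ha₀ b hb hab
        · cases k with
          | plain => exact h₁.value_unr hV (.arrow _ _ _) a ha
          | unord => exact hs.2 (.inl rfl) a ha b (h₀ b hb) hab
          | right => exact he' (Fin.le_zero_iff.1 (he.trans_eq (hr rfl)))
          | left => exact hk rfl
      · intro N' A₀' R' A' hN' hc hA'
        obtain ⟨B, hB⟩ : ∃ B : Set (Tok M), ∀ a, a ∈ B ↔ (a ∈ A₂ ∧ a ∉ A₀) ∨ a ∈ A₀' :=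
          ⟨_, fun _ => Iff.rfl⟩
        replace h₂ := hrep N' A₀' R' B hN' (hc.restrict (by grind)) hB
        replace h₁ := RTyping.weaken (R' := R') h₁ (fun _ _ h => h)
          (fun a ha b hb h => hc.rest a (by grind) (by grind) b (by grind) (by grind) h) le_rfl
        obtain ⟨hc₁, hc₂, hc₃, hc₄, hc₅⟩ := hc
        exact .app (by grind) (by grind) (hs.anti (by grind) (by grind)) hr hl h₁ h₂ he₀ he₁ he₂
  | leftFun E V hV ih =>
    cases h with
    | @app _ _ A₁ A₂ _ _ _ _ S _ _ e' e₁ e₂ hAA hd hs hr hl h₁ h₂ he₀ he₁ he₂ =>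
      obtain ⟨A₀, S₀, e₀, h₀, hN, he, hmin, hrep⟩ := ih h₁ (by grind)
      refine ⟨A₀, S₀, e₀, by grind, hN, he.trans he₁, ?_, ?_⟩
      · intro he'
        exact absurd (Fin.le_zero_iff.1 (he.trans_eq (hl rfl))) he'
      · intro N' A₀' R' A' hN' hc hA'
        obtain ⟨B, hB⟩ : ∃ B : Set (Tok M), ∀ a, a ∈ B ↔ (a ∈ A₁ ∧ a ∉ A₀) ∨ a ∈ A₀' :=
          ⟨_, fun _ => Iff.rfl⟩
        replace h₁ := hrep N' A₀' R' B hN' (hc.restrict (by grind)) hB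
        replace h₂ := RTyping.weaken (R' := R') h₂ (fun _ _ h => h)
          (fun a ha b hb h => hc.rest a (by grind) (by grind) b (by grind) (by grind) h) le_rfl
        obtain ⟨hc₁, hc₂, hc₃, hc₄, hc₅⟩ := hc
        exact .app (by grind) (by grind) (hs.anti (by grind) (by grind)) hr hl h₁ h₂ he₀ he₁ he₂
  | leftArg N₁ E ih =>
    cases h with
    | @app _ _ A₁ A₂ _ _ _ _ S _ _ e' e₁ e₂ hAA hd hs hr hl h₁ h₂ he₀ he₁ he₂ =>
      obtain ⟨A₀, S₀, e₀, h₀, hN, he, hmin, hrep⟩ := ih h₂ (by grind)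
      refine ⟨A₀, S₀, e₀, by grind, hN, he.trans he₂, ?_, ?_⟩
      · intro he' a ha ha₀ b hb hab
        rcases (hAA a).1 ha with ha | ha
        swap
        · exact hmin he' a ha ha₀ b hb hab
        · exact hs.2 (.inr rfl) a ha b (h₀ b hb) hab
      · intro N' A₀' R' A' hN' hc hA'
        obtain ⟨B, hB⟩ : ∃ B : Set (Tok M), ∀ a, a ∈ B ↔ (a ∈ A₂ ∧ a ∉ A₀) ∨ a ∈ A₀' :=
          ⟨_, fun _ => Iff.rfl⟩
        replace h₂ := hrep N' A₀' R' B hN' (hc.restrict (by grind)) hB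
        replace h₁ := RTyping.weaken (R' := R') h₁ (fun _ _ h => h)
          (fun a ha b hb h => hc.rest a (by grind) (by grind) b (by grind) (by grind) h) le_rfl
        obtain ⟨hc₁, hc₂, hc₃, hc₄, hc₅⟩ := hc
        exact .app (by grind) (by grind) (hs.anti (by grind) (by grind)) hr hl h₁ h₂ he₀ he₁ he₂
  | pairFst p E N₂ ih =>
    cases h with
    | @pair _ _ A₁ A₂ _ _ _ _ S _ _ e₁ e₂ hAA hd hs hp h₁ h₂ he₁ he₂ =>
      obtain ⟨A₀, S₀, e₀, h₀, hN, he, hmin, hrep⟩ := ih h₁ (by grind)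
      refine ⟨A₀, S₀, e₀, by grind, hN, he.trans he₁, ?_, ?_⟩
      · intro he' a ha ha₀ b hb hab
        rcases (hAA a).1 ha with ha | ha
        · exact hmin he' a ha ha₀ b hb hab
        · exact hs.1 b (h₀ b hb) a ha hab
      · intro N' A₀' R' A' hN' hc hA'
        obtain ⟨B, hB⟩ : ∃ B : Set (Tok M), ∀ a, a ∈ B ↔ (a ∈ A₁ ∧ a ∉ A₀) ∨ a ∈ A₀' :=
          ⟨_, fun _ => Iff.rfl⟩
        replace h₁ := hrep N' A₀' R' B hN' (hc.restrict (by grind)) hB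
        replace h₂ := RTyping.weaken (R' := R') h₂ (fun _ _ h => h)
          (fun a ha b hb h => hc.rest a (by grind) (by grind) b (by grind) (by grind) h) le_rfl
        obtain ⟨hc₁, hc₂, hc₃, hc₄, hc₅⟩ := hc
        exact .pair (by grind) (by grind) (hs.anti (by grind) (by grind)) hp h₁ h₂ he₁ he₂
  | pairSnd p V hV E ih =>
    cases h with
    | @pair _ _ A₁ A₂ _ _ _ _ S _ _ e₁ e₂ hAA hd hs hp h₁ h₂ he₁ he₂ =>
      obtain ⟨A₀, S₀, e₀, h₀, hN, he, hmin, hrep⟩ := ih h₂ (by grind)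
      refine ⟨A₀, S₀, e₀, by grind, hN, he.trans he₂, ?_, ?_⟩
      · intro he' a ha ha₀ b hb hab
        rcases (hAA a).1 ha with ha | ha
        swap
        · exact hmin he' a ha ha₀ b hb hab
        · cases p with
          | unord => exact hs.2 rfl a ha b (h₀ b hb) hab
          | ord =>
            by_cases hS : S.Unr
            · exact h₁.value_unr hV hS a ha
            · exact he' (Fin.le_zero_iff.1 (he.trans_eq (hp rfl hS)))
      · intro N' A₀' R' A' hN' hc hA'
        obtain ⟨B, hB⟩ : ∃ B : Set (Tok M), ∀ a, a ∈ B ↔ (a ∈ A₂ ∧ a ∉ A₀) ∨ a ∈ A₀' :=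
          ⟨_, fun _ => Iff.rfl⟩
        replace h₂ := hrep N' A₀' R' B hN' (hc.restrict (by grind)) hB
        replace h₁ := RTyping.weaken (R' := R') h₁ (fun _ _ h => h)
          (fun a ha b hb h => hc.rest a (by grind) (by grind) b (by grind) (by grind) h) le_rfl
        obtain ⟨hc₁, hc₂, hc₃, hc₄, hc₅⟩ := hc
        exact .pair (by grind) (by grind) (hs.anti (by grind) (by grind)) hp h₁ h₂ he₁ he₂
  | letPair p x y E N₂ ih =>
    cases h with
    | @letPair _ _ A₁ A'' _ Q _ _ _ _ _ S₁ S₂ _ _ hxy hx hy hA₁ hA'' hR' hin₁ hin₂ hout₁ hout₂ hord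
        h₁ h₂ =>
      obtain ⟨A₀, S₀, e₀, h₀, hN, he, hmin, hrep⟩ := ih h₁ (by grind)
      refine ⟨A₀, S₀, e₀, by grind, hN, he.trans (Fin.zero_le _), ?_, ?_⟩
      · intro he'
        exact absurd (Fin.le_zero_iff.1 he) he'
      · intro N' A₀' R' A' hN' hc hA'
        obtain ⟨B, hB⟩ : ∃ B : Set (Tok M), ∀ a, a ∈ B ↔ (a ∈ A₁ ∧ a ∉ A₀) ∨ a ∈ A₀' :=
          ⟨_, fun _ => Iff.rfl⟩
        replace h₁ := hrep N' A₀' R' B hN' (hc.restrict (by grind)) hB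
        obtain ⟨hc₁, hc₂, hc₃, hc₄, hc₅⟩ := hc
        have hvar : ∀ x S', Tok.var x S' ∉ A₀' := fun x S' h => by
          obtain ⟨i, l, m, h⟩ := hc₁ _ h
          cases h
        have hin : ∀ a ∈ A', a ∉ B → ∀ b ∈ B, R' a b → a ∈ A ∧ a ∉ A₁ ∧ ∃ b' ∈ A₁, R a b' := by grind
        have hout : ∀ a ∈ A', a ∉ B → ∀ b ∈ B, R' b a → a ∈ A ∧ a ∉ A₁ ∧ ∃ b' ∈ A₁, R b' a := by
          grind
        refine .letPair hxy (by grind) (by grind) (by grind) (by grind) (by grind) ?_ ?_ ?_ ?_ hord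
          h₁ h₂
        · intro hS a ha haB b hb hab
          obtain ⟨h₁, h₂, b', h₃, h₄⟩ := hin a ha haB b hb hab
          exact hin₁ hS a h₁ h₂ b' h₃ h₄
        · intro hS a ha haB b hb hab
          obtain ⟨h₁, h₂, b', h₃, h₄⟩ := hin a ha haB b hb hab
          exact hin₂ hS a h₁ h₂ b' h₃ h₄
        · intro hS a ha haB b hb hab
          obtain ⟨h₁, h₂, b', h₃, h₄⟩ := hout a ha haB b hb hab
          exact hout₁ hS a h₁ h₂ b' h₃ h₄
        · intro hS a ha haB b hb hab
          obtain ⟨h₁, h₂, b', h₃, h₄⟩ := hout a ha haB b hb hab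
          exact hout₂ hS a h₁ h₂ b' h₃ h₄

theorem CTyping.value_or_reducible {A : Set (Tok M)} {R : Tok M → Tok M → Prop} {N : Term M}
    {T : Ty M} {e : Eff} (h : CTyping A R N T e) (hA : ∀ a ∈ A, a.IsLoc) :
    N.IsValue ∨ N.Reducible := by
  induction N generalizing A R T e with
  | const c => exact .inl (.const c)
  | loc l => exact .inl (.loc l)
  | lam k x N => exact .inl (.lam k x N)
  | var x =>
    cases h with
    | uvar hU => exact hU.elim
    | ovar hA' =>
      obtain ⟨i, l, m, h⟩ := hA _ ((hA' _).2 rfl)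
      cases h
  | pair p N₁ N₂ ih₁ ih₂ =>
    cases h with
    | pair hAA hd hs hp h₁ h₂ =>
      rcases ih₁ h₁ (by grind) with hV | ⟨E, N₀, rfl, h₀⟩
      · rcases ih₂ h₂ (by grind) with hV' | ⟨E, N₀, rfl, h₀⟩
        · exact .inl (.pair p hV hV')
        · exact .inr ⟨.pairSnd p _ hV E, N₀, rfl, h₀⟩
      · exact .inr ⟨.pairFst p E _, N₀, rfl, h₀⟩
  | letPair p x y N₁ N₂ ih₁ ih₂ =>
    right
    cases h with
    | letPair hxy hx hy hA₀ hA' hR' _ _ _ _ hord h₁ h₂ =>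
      rcases ih₁ h₁ (by grind) with hV | ⟨E, N₀, rfl, h₀⟩
      · refine ⟨.hole, _, rfl, .inl ?_⟩
        cases hV with
        | const c => cases h₁ with | const hc => cases hc
        | loc => cases h₁
        | lam => cases h₁
        | pair p' hV₁ hV₂ =>
          cases h₁
          exact ⟨_, .letPair _ _ _ _ _ _ hxy hV₁ hV₂⟩
      · exact ⟨.letPair p x y E _, N₀, rfl, h₀⟩
  | app k N₁ N₂ ih₁ ih₂ =>
    right
    cases h with
    | app hAA hd hs hr hl h₁ h₂ =>
      have hred : N₁.IsValue → N₂.IsValue → (Term.app k N₁ N₂).Reducible := by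
        intro hV₁ hV₂
        refine ⟨.hole, _, rfl, ?_⟩
        cases hV₁ with
        | loc | pair => cases h₁
        | lam k' x N =>
          cases h₁
          exact .inl ⟨_, .beta _ _ _ _ hV₂⟩
        | const c =>
          cases h₁ with
          | const hc =>
            cases hc with
            | new m =>
              cases hV₂ with
              | const c =>
                cases h₂ with | const hc => cases hc; exact .inr (.inl ⟨m, rfl⟩)
              | loc | lam | pair => cases h₂
            | op | split | drop =>
              cases hV₂ with
              | const c => cases h₂ with | const hc => cases hc
              | loc l => exact .inr (.inr ⟨_, l, rfl⟩)
              | lam | pair => cases h₂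
      by_cases hk : k = .left
      · subst hk
        rcases ih₂ h₂ (by grind) with hV | ⟨E, N₀, rfl, h₀⟩
        · rcases ih₁ h₁ (by grind) with hV' | ⟨E, N₀, rfl, h₀⟩
          · exact hred hV' hV
          · exact ⟨.leftFun E _ hV, N₀, rfl, h₀⟩
        · exact ⟨.leftArg _ E, N₀, rfl, h₀⟩
      · rcases ih₁ h₁ (by grind) with hV | ⟨E, N₀, rfl, h₀⟩
        · rcases ih₂ h₂ (by grind) with hV' | ⟨E, N₀, rfl, h₀⟩
          · exact hred hV hV'
          · exact ⟨.appArg k hk _ hV E, N₀, rfl, h₀⟩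
        · exact ⟨.appFun k hk E _, N₀, rfl, h₀⟩

/-- `ProdLE m [m₁, …, mₖ] m₀`: the product `m ⊙ m₁ ⊙ … ⊙ mₖ` is defined and `≤ m₀`. -/
def ProdLE : M → List M → M → Prop
  | m, [], m₀ => m ≤ m₀
  | m, a :: L, m₀ => ∃ p, OPM.pmul m a = some p ∧ ProdLE p L m₀

theorem ProdLE.mono {m m' m₀ : M} {L : List M} (h : ProdLE m L m₀) (hm : m' ≤ m) :
    ProdLE m' L m₀ := by
  induction L generalizing m m' with
  | nil => exact hm.trans h
  | cons a L ih =>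
    obtain ⟨p, hp, h⟩ := h
    obtain ⟨p', hp', hle⟩ := OPM.pmul_mono hm (le_refl a) hp
    exact ⟨p', hp', ih h hle⟩

theorem ProdLE.split {a b c m m₀ : M} {L₁ L₂ : List M} (habc : MulLE a b c)
    (h : ProdLE m (L₁ ++ c :: L₂) m₀) : ProdLE m (L₁ ++ a :: b :: L₂) m₀ := by
  induction L₁ generalizing m with
  | nil =>
    obtain ⟨p, hp, h⟩ := h
    obtain ⟨q, hq, hle⟩ := habc
    obtain ⟨r, hr, hrp⟩ := OPM.pmul_mono (le_refl m) hle hp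
    have := OPM.pmul_assoc m a b
    rw [hq, Option.bind_some, hr, Option.bind_eq_some_iff] at this
    obtain ⟨s, hs, hs'⟩ := this
    exact ⟨s, hs, r, hs', h.mono hrp⟩
  | cons d L₁ ih =>
    obtain ⟨p, hp, h⟩ := h
    exact ⟨p, hp, ih h⟩

theorem ProdLE.drop {c m m₀ : M} {L₁ L₂ : List M} (hc : OPM.eps ≤ c)
    (h : ProdLE m (L₁ ++ c :: L₂) m₀) : ProdLE m (L₁ ++ L₂) m₀ := by
  induction L₁ generalizing m with
  | nil =>
    obtain ⟨p, hp, h⟩ := h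
    obtain ⟨r, hr, hrp⟩ := OPM.pmul_mono (le_refl m) hc hp
    rw [OPM.pmul_eps, Option.some_inj] at hr
    subst hr
    exact h.mono hrp
  | cons d L₁ ih =>
    obtain ⟨p, hp, h⟩ := h
    exact ⟨p, hp, ih h⟩

theorem ProdLE.exists_mulLE {m m₀ : M} {L : List M} (h : ProdLE m L m₀) :
    ∃ m', MulLE m m' m₀ := by
  induction L generalizing m with
  | nil => exact ⟨OPM.eps, m, OPM.pmul_eps m, h⟩
  | cons a L ih =>
    obtain ⟨p, hp, h⟩ := h
    obtain ⟨m', q, hq, hle⟩ := ih h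
    have := OPM.pmul_assoc m a m'
    rw [hp, Option.bind_some, hq, eq_comm, Option.bind_eq_some_iff] at this
    obtain ⟨r, hr, hr'⟩ := this
    exact ⟨r, q, hr', hle⟩

def CellOK (A : Set (Tok M)) (R : Tok M → Tok M → Prop) (l : Loc) (o : Option (Cell M)) : Prop :=
  ∃ L, CellToks A R l L ∧ (o = none → L = []) ∧
    ∀ n m₀ m, o = some ⟨n, m₀, m⟩ → L.length = n + 1 ∧ ProdLE m (L.map Prod.snd) m₀

/-- Invariant of configurations. -/
def ConfigOK (N : Term M) (H : Heap M) (T : Ty M) : Prop :=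
  ∃ A R e, CTyping A R N T e ∧ (∀ a ∈ A, a.IsLoc) ∧ ∀ l, CellOK A R l (H.lookup l)

/-- Replacement of a binding of `l` by the bindings in `K`. -/
theorem CellToks.replace {A A₀ : Set (Tok M)} {R : Tok M → Tok M → Prop} {l : Loc}
    {L₁ L₂ K : List (ℕ × M)} {i : ℕ} {m : M} (h : CellToks A R l (L₁ ++ (i, m) :: L₂))
    (hA₀ : ∀ a, a ∈ A₀ ↔ a = .loc i l m)
    (hK : K.Pairwise fun p q => p.1 < q.1)
    (hKL : ∀ p ∈ K, ∀ q ∈ L₁ ++ (i, m) :: L₂, q.1 < p.1) :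
    ∃ (A₀' A' : Set (Tok M)) (R' : Tok M → Tok M → Prop),
      (∀ a, a ∈ A₀' ↔ ∃ p ∈ K, a = .loc p.1 l p.2) ∧
      (∀ a, a ∈ A' ↔ (a ∈ A ∧ a ∉ A₀) ∨ a ∈ A₀') ∧
      Compat A A₀ A₀' R R' ∧
      (∀ p ∈ K, ∀ q ∈ K, R' (.loc p.1 l p.2) (.loc q.1 l q.2) → p.1 < q.1) ∧
      (∀ l' ≠ l, ∀ o, CellOK A R l' o → CellOK A' R' l' o) ∧
      CellToks A' R' l (L₁ ++ K ++ L₂) := by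
  obtain ⟨A₀', hA₀'⟩ : ∃ A₀' : Set (Tok M), ∀ a, a ∈ A₀' ↔ ∃ p ∈ K, a = .loc p.1 l p.2 :=
    ⟨_, fun _ => Iff.rfl⟩
  obtain ⟨A', hA'⟩ : ∃ A' : Set (Tok M), ∀ a, a ∈ A' ↔ (a ∈ A ∧ a ∉ A₀) ∨ a ∈ A₀' :=
    ⟨_, fun _ => Iff.rfl⟩
  obtain ⟨R', hR'⟩ : ∃ R' : Tok M → Tok M → Prop, ∀ a b, R' a b ↔
      (a ∈ A₀' ∧ b ∈ A₀' ∧ ∃ p q : ℕ × M, p.1 < q.1 ∧ a = .loc p.1 l p.2 ∧ b = .loc q.1 l q.2) ∨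
      (a ∉ A₀' ∧ b ∉ A₀' ∧ R a b) ∨ (a ∈ A₀' ∧ b ∉ A₀' ∧ R (.loc i l m) b) ∨
      (a ∉ A₀' ∧ b ∈ A₀' ∧ R a (.loc i l m)) := ⟨_, fun _ _ => Iff.rfl⟩
  have hKA : ∀ a ∈ A₀', a ∉ A := by
    intro a ha ha'
    obtain ⟨p, hp, rfl⟩ := (hA₀' a).1 ha
    exact lt_irrefl _ (hKL p hp _ ((h.mem _ _).1 ha'))
  have hKmem : ∀ p ∈ K, Tok.loc p.1 l p.2 ∈ A₀' := fun p hp => (hA₀' _).2 ⟨p, hp, rfl⟩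
  have hLmem : ∀ p ∈ L₁ ++ (i, m) :: L₂, Tok.loc p.1 l p.2 ∉ A₀' := fun p hp hp' =>
    hKA _ hp' ((h.mem _ _).2 hp)
  refine ⟨A₀', A', R', hA₀', hA', ⟨?_, ?_, ?_, ?_, ?_⟩, ?_, ?_, ?_, ?_, ?_⟩
  · intro a ha
    obtain ⟨p, hp, rfl⟩ := (hA₀' a).1 ha
    exact ⟨_, _, _, rfl⟩
  · exact fun a ha ha' => absurd ha' (hKA a ha)
  · grind
  · intro a ha ha₀ b hb hab
    exact ⟨.loc i l m, (hA₀ _).2 rfl, by grind⟩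
  · intro a ha ha₀ b hb hab
    exact ⟨.loc i l m, (hA₀ _).2 rfl, by grind⟩
  · intro p hp q hq hR
    have h₁ := hKmem p hp
    have h₂ := hKmem q hq
    grind
  · rintro l' hl' o ⟨L, hL, ho⟩
    have hl₀ : ∀ j a, Tok.loc j l' a ∉ A₀' := by
      intro j a h
      obtain ⟨p, hp, h⟩ := (hA₀' _).1 h
      cases h
      exact hl' rfl
    refine ⟨L, hL.frame ?_ ?_, ho⟩ <;> grind
  · have := h.nodup
    have hKn : K.Nodup := hK.imp (fun h h' => by subst h'; exact lt_irrefl _ h)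
    have hKd : ∀ p ∈ K, ∀ q ∈ L₁ ++ (i, m) :: L₂, q ≠ p := by
      rintro p hp q hq rfl
      exact lt_irrefl _ (hKL q hp q hq)
    simp only [List.mem_append, List.mem_cons] at hKd
    simp only [List.nodup_append, List.nodup_cons, List.mem_cons, List.mem_append] at this ⊢
    refine ⟨⟨this.1, hKn, fun p hp q hq => hKd q hq p (.inl hp)⟩, this.2.1.2, ?_⟩
    rintro p (hp | hp) q hq
    · exact this.2.2 p hp q (.inr hq)
    · exact (hKd p hp q (.inr (.inr hq))).symm
  · intro j a
    rw [hA', h.mem]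
    have hn := h.nodup
    rw [List.nodup_append, List.nodup_cons] at hn
    grind
  · have hp := h.pairwise
    simp only [List.pairwise_append, List.pairwise_cons, List.mem_append, List.mem_cons] at hp ⊢
    refine ⟨⟨?_, ?_, ?_⟩, ?_, ?_⟩
    · refine hp.1.imp_of_mem fun {p q} h₁ h₂ hR => ?_
      have := hLmem p (by simp [h₁])
      have := hLmem q (by simp [h₂])
      grind
    · refine hK.imp_of_mem fun {p q} h₁ h₂ hR => ?_
      exact (hR' _ _).2 (.inl ⟨hKmem p h₁, hKmem q h₂, p, q, hR, rfl, rfl⟩)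
    · intro p h₁ q h₂
      exact (hR' _ _).2 (.inr (.inr (.inr
        ⟨hLmem p (by simp [h₁]), hKmem q h₂, hp.2.2 p h₁ (i, m) (.inl rfl)⟩)))
    · refine hp.2.1.2.imp_of_mem fun {p q} h₁ h₂ hR => ?_
      have := hLmem p (by simp [h₁])
      have := hLmem q (by simp [h₂])
      grind
    · rintro p (h₁ | h₁) q h₂
      · have := hLmem p (by simp [h₁])
        have := hLmem q (by simp [h₂])
        grind
      · have := hKmem p h₁
        have := hLmem q (by simp [h₂])
        grind

theorem CTyping.app_const_loc {A : Set (Tok M)} {R : Tok M → Tok M → Prop} {c : Const M} {l : Loc}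
    {T : Ty M} {e : Eff} (h : CTyping A R (.app .plain (.const c) (.loc l)) T e) :
    ∃ i m e', (∀ a, a ∈ A ↔ a = .loc i l m) ∧ ConstTyping c (.arrow .plain (.res m) e' T) ∧
      e' ≤ e := by
  cases h with
  | app hA hd hs hr hl h₁ h₂ he₀ =>
    cases h₁ with
    | const hc hA₁ =>
      cases h₂ with
      | loc i hA₂ => exact ⟨i, _, _, by grind, hc, he₀⟩

theorem CTyping.app_new {A : Set (Tok M)} {R : Tok M → Tok M → Prop} {m : M} {N : Term M}
    {T : Ty M} {e : Eff} (h : CTyping A R (.app .plain (.const (.new m)) N) T e)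
    (hN : N.IsValue) : (∀ a, a ∉ A) ∧ T = .res m := by
  cases h with
  | app hA hd hs hr hl h₁ h₂ he₀ =>
    cases h₁ with
    | const hc hA₁ =>
      cases hc
      have := h₂.value_unr hN .unit
      exact ⟨by grind, rfl⟩

/-- The location of a binding is in the heap, and the binding has a place among those of the
location, the first place if there is no edge to it. -/
theorem CellOK.exists_of_mem {A A₀ : Set (Tok M)} {R : Tok M → Tok M → Prop} {l : Loc}
    {o : Option (Cell M)} {i : ℕ} {m : M} (h : CellOK A R l o) (hA : ∀ a ∈ A₀, a ∈ A)
    (hA₀ : ∀ a, a ∈ A₀ ↔ a = .loc i l m) :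
    ∃ n m₀ m' L₁ L₂, o = some ⟨n, m₀, m'⟩ ∧ CellToks A R l (L₁ ++ (i, m) :: L₂) ∧
      L₁.length + L₂.length = n ∧
      ProdLE m' (L₁.map Prod.snd ++ m :: L₂.map Prod.snd) m₀ ∧
      ((∀ a ∈ A, a ∉ A₀ → ∀ b ∈ A₀, ¬ R a b) → L₁ = []) := by
  obtain ⟨L, hL, ho, hcell⟩ := h
  have hmem := (hL.mem i m).1 (hA _ ((hA₀ _).2 rfl))
  obtain ⟨L₁, L₂, rfl⟩ := List.append_of_mem hmem
  cases o with
  | none => simp at ho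
  | some c =>
    obtain ⟨n, m₀, m'⟩ := c
    obtain ⟨h₁, h₂⟩ := hcell n m₀ m' rfl
    refine ⟨n, m₀, m', L₁, L₂, rfl, hL, by simp at h₁; omega, by simpa using h₂, ?_⟩
    intro hmin
    rcases L₁ with _ | ⟨p, L₁⟩
    · rfl
    · exfalso
      refine hmin (.loc p.1 l p.2) ((hL.mem _ _).2 (by simp)) ?_ (.loc i l m) ((hA₀ _).2 rfl) ?_
      · intro h
        have h := (hA₀ _).1 h
        have hn := hL.nodup
        have : p = (i, m) := by
          cases p; cases h; rfl
        simp [this] at hn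
      · have := hL.pairwise
        simp only [List.cons_append, List.pairwise_cons] at this
        exact this.1 (i, m) (by simp)

theorem ConfigOK.beta {E : ECtx M} {N N' : Term M} {H : Heap M} {T : Ty M}
    (h : ConfigOK (E.fill N) H T) (hN : BetaStep N N') : ConfigOK (E.fill N') H T := by
  obtain ⟨A, R, e, h, hA, hH⟩ := h
  obtain ⟨A₀, S, e₀, h₀, hN₀, -, -, hrep⟩ := CTyping.fill E h hA
  refine ⟨A, R, e, hrep N' A₀ R A (hN₀.beta (fun a ha => hA a (h₀ a ha)) hN) ⟨?_, ?_, ?_, ?_, ?_⟩ ?_,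
    hA, hH⟩
  · exact fun a ha => hA a (h₀ a ha)
  all_goals grind

theorem ConfigOK.cfgStep {E : ECtx M} {N N' : Term M} {H H' : Heap M} {T : Ty M}
    (h : ConfigOK (E.fill N) H T) (hN : CfgStep N H N' H') : ConfigOK (E.fill N') H' T := by
  obtain ⟨A, R, e, h, hA, hH⟩ := h
  obtain ⟨A₀, S, e₀, h₀, hN₀, -, hmin, hrep⟩ := CTyping.fill E h hA
  -- operations on a location replace one of its bindings
  have key : ∀ (l : Loc) (c : Const M), N = .app .plain (.const c) (.loc l) →
      ∃ (i : ℕ) (m : M) (e' : Eff) (n : ℕ) (m₀ m' : M) (L₁ L₂ : List M) (j : ℕ),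
        ConstTyping c (.arrow .plain (.res m) e' S) ∧
        H.lookup l = some ⟨n, m₀, m'⟩ ∧ L₁.length + L₂.length = n ∧
        ProdLE m' (L₁ ++ m :: L₂) m₀ ∧ (e' ≠ 0 → L₁ = []) ∧
        ∀ (K : List (ℕ × M)) (o : Option (Cell M)), (K.Pairwise fun p q => p.1 < q.1) →
          (∀ p ∈ K, j ≤ p.1) →
          (∀ (A₀' : Set (Tok M)) (R' : Tok M → Tok M → Prop),
            (∀ a, a ∈ A₀' ↔ ∃ p ∈ K, a = .loc p.1 l p.2) →
            (∀ p ∈ K, ∀ q ∈ K, R' (.loc p.1 l p.2) (.loc q.1 l q.2) → p.1 < q.1) →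
            CTyping A₀' R' N' S e₀) →
          (∀ l' ≠ l, H'.lookup l' = H.lookup l') → H'.lookup l = o →
          (o = none → L₁ = [] ∧ K = [] ∧ L₂ = []) →
          (∀ n' m₀' m', o = some ⟨n', m₀', m'⟩ → L₁.length + K.length + L₂.length = n' + 1 ∧
            ProdLE m' (L₁ ++ K.map Prod.snd ++ L₂) m₀') →
          ConfigOK (E.fill N') H' T := by
    rintro l c rfl
    obtain ⟨i, m, e', hA₀, hc, he'⟩ := hN₀.app_const_loc
    obtain ⟨n, m₀, m', L₁, L₂, hl, hL, hn, hprod, hfirst⟩ := (hH l).exists_of_mem h₀ hA₀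
    obtain ⟨j, hj⟩ := exists_fresh_id (L₁ ++ (i, m) :: L₂)
    refine ⟨i, m, e', n, m₀, m', L₁.map Prod.snd, L₂.map Prod.snd, j, hc, hl, by simpa using hn,
      hprod, ?_, ?_⟩
    · intro he
      rw [hfirst (hmin ?_)]
      · rfl
      · rintro rfl
        exact he (Fin.le_zero_iff.1 he')
    · intro K o hK hKj hN' hH' hlo hnone hsome
      obtain ⟨A₀', A', R', hA₀', hA', hcompat, hKR, hother, htoks⟩ :=
        hL.replace hA₀ hK (fun p hp q hq => (hj q hq).trans_le (hKj p hp))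
      refine ⟨A', R', e, hrep N' A₀' R' A' (hN' A₀' R' hA₀' hKR) hcompat hA', ?_, ?_⟩
      · intro a ha
        rcases (hA' a).1 ha with ha | ha
        exacts [hA a ha.1, hcompat.isLoc a ha]
      · intro l'
        by_cases hl' : l' = l
        · subst hl'
          refine ⟨_, htoks, ?_, ?_⟩
          · rw [hlo]
            intro ho
            simpa [and_assoc] using hnone ho
          · intro n' m₀' m'' ho
            rw [hlo] at ho
            simpa [add_assoc] using hsome n' m₀' m'' ho
        · rw [hH' l' hl']
          exact hother l' hl' _ (hH l')
  cases hN with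
  | new m l H hl =>
    obtain ⟨hA₀, rfl⟩ := hN₀.app_new (.const _)
    have hl' := Finmap.lookup_eq_none.2 hl
    have hlA : ∀ i m, Tok.loc i l m ∉ A := by
      intro i m h
      obtain ⟨L, hL, hnone, -⟩ := hH l
      have := (hL.mem i m).1 h
      simp [hnone hl'] at this
    obtain ⟨A', hA'⟩ : ∃ A' : Set (Tok M), ∀ a, a ∈ A' ↔ a ∈ A ∨ a = .loc 0 l m :=
      ⟨_, fun _ => Iff.rfl⟩
    obtain ⟨R', hR'⟩ : ∃ R' : Tok M → Tok M → Prop, ∀ a b, R' a b ↔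
        R a b ∧ a ≠ .loc 0 l m ∧ b ≠ .loc 0 l m := ⟨_, fun _ _ => Iff.rfl⟩
    refine ⟨A', R', e, hrep _ {.loc 0 l m} R' A' (.loc 0 (by simp)) ⟨?_, ?_, ?_, ?_, ?_⟩ ?_, ?_, ?_⟩
    · rintro a rfl
      exact ⟨_, _, _, rfl⟩
    · rintro a rfl h
      exact absurd h (hlA _ _)
    · grind
    · rintro a ha ha₀ b rfl hab
      exact absurd rfl ((hR' _ _).1 hab).2.2
    · rintro a ha ha₀ b rfl hab
      exact absurd rfl ((hR' _ _).1 hab).2.1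
    · intro a
      rw [hA', Set.mem_singleton_iff]
      grind
    · intro a ha
      rcases (hA' a).1 ha with ha | rfl
      exacts [hA a ha, ⟨_, _, _, rfl⟩]
    · intro l'
      by_cases hll : l' = l
      · subst hll
        rw [Finmap.lookup_insert]
        refine ⟨[(0, m)], ⟨by simp, ?_, by simp⟩, by simp, ?_⟩
        · intro i m'
          have := hlA i m'
          simp [hA', this]
        · rintro n m₀ m' h
          cases h
          exact ⟨rfl, m, OPM.eps_pmul m, le_rfl⟩
      · rw [Finmap.lookup_insert_of_ne _ hll]
        obtain ⟨L, hL, ho⟩ := hH l'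
        refine ⟨L, hL.frame ?_ ?_, ho⟩ <;> grind
  | op m l H n m₀ m' p hl hp hadm =>
    obtain ⟨i, m₂, e', n, m₀, m', L₁, L₂, j, hc, hl', hn, hprod, hfirst, hnext⟩ := key l _ rfl
    rw [hl] at hl'
    cases hl'
    cases hc with
    | op _ _ m₃ hm =>
      obtain rfl := hfirst one_ne_zero
      obtain ⟨p', hp', hprod⟩ := ProdLE.split (L₁ := []) hm hprod
      rw [hp] at hp'
      cases hp'
      refine hnext [(j, m₃)] _ (by simp) (by simp) ?_
        (fun l' h => Finmap.lookup_insert_of_ne _ h) (Finmap.lookup_insert _) (by simp) ?_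
      · intro A₀' R' hA₀' hR'
        exact .loc j (by simpa using hA₀')
      · rintro n' m₀' m' h
        cases h
        exact ⟨by simp at hn ⊢; omega, hprod⟩
  | dropShared l H n m₀ m hl =>
    obtain ⟨i, m₂, e', n, m₀, m', L₁, L₂, j, hc, hl', hn, hprod, hfirst, hnext⟩ := key l _ rfl
    rw [hl] at hl'
    cases hl'
    cases hc with
    | drop _ hm =>
      refine hnext [] _ (by simp) (by simp) ?_
        (fun l' h => Finmap.lookup_insert_of_ne _ h) (Finmap.lookup_insert _) (by simp) ?_
      · intro A₀' R' hA₀' hR'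
        exact .const .unit (by simpa using hA₀')
      · rintro n' m₀' m' h
        cases h
        exact ⟨by simpa using hn, by simpa using hprod.drop hm⟩
  | dropLast l H m₀ m hl hle =>
    obtain ⟨i, m₂, e', n, m₀, m', L₁, L₂, j, hc, hl', hn, hprod, hfirst, hnext⟩ := key l _ rfl
    rw [hl] at hl'
    cases hl'
    cases hc with
    | drop _ hm =>
      refine hnext [] none (by simp) (by simp) ?_
        (fun l' h => Finmap.lookup_erase_ne h) (Finmap.lookup_erase _ _) ?_ (by simp)
      · intro A₀' R' hA₀' hR'
        exact .const .unit (by simpa using hA₀')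
      · simpa using hn
  | split m₁ m₂ l H n m₀ m hl =>
    obtain ⟨i, m₃, e', n, m₀, m', L₁, L₂, j, hc, hl', hn, hprod, hfirst, hnext⟩ := key l _ rfl
    rw [hl] at hl'
    cases hl'
    cases hc with
    | split _ _ _ hm =>
      refine hnext [(j, m₁), (j + 1, m₂)] _ (by simp) (by simp) ?_
        (fun l' h => Finmap.lookup_insert_of_ne _ h) (Finmap.lookup_insert _) (by simp) ?_
      · intro A₀' R' hA₀' hR'
        refine .pair (A₁ := {.loc j l m₁}) (A₂ := {.loc (j + 1) l m₂}) (e₁ := 0) (e₂ := 0)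
          (by simpa using hA₀') ?_ ⟨?_, by simp⟩ (fun _ _ => rfl) (.loc j (by simp))
          (.loc (j + 1) (by simp)) (Fin.zero_le _) (Fin.zero_le _)
        · rintro a rfl h
          cases h
        · rintro a rfl b rfl h
          have := hR' (j + 1, m₂) (by simp) (j, m₁) (by simp) h
          simp at this
      · rintro n' m₀' m' h
        cases h
        exact ⟨by simp; omega, by simpa using hprod.split hm⟩

theorem ConfigOK.steps {N N' : Term M} {H H' : Heap M} {T : Ty M}
    (h : ConfigOK N H T) (hs : Steps (N, H) (N', H')) : ConfigOK N' H' T := by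
  have : ∀ c c' : Config M, ConfigOK c.1 c.2 T → Step c c' → ConfigOK c'.1 c'.2 T := by
    rintro _ _ h (⟨E, N, N', H, hN⟩ | ⟨E, N, N', H, H', hN⟩)
    exacts [h.beta hN, h.cfgStep hN]
  unfold Steps at hs
  generalize hc : (N', H') = c at hs
  induction hs generalizing N' H' with
  | refl => cases hc; exact h
  | tail _ hstep ih => subst hc; exact this _ _ (ih rfl) hstep

theorem ConfigOK.admissible {N : Term M} {H : Heap M} {T : Ty M} (h : ConfigOK N H T) (l : Loc)
    (n : ℕ) (m₀ m : M) (hl : H.lookup l = some ⟨n, m₀, m⟩) : ∃ m', MulLE m m' m₀ := by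
  obtain ⟨A, R, e, -, -, hH⟩ := h
  obtain ⟨L, -, -, hcell⟩ := hH l
  exact (hcell n m₀ m hl).2.exists_mulLE

theorem ConfigOK.value_or_step {N : Term M} {H : Heap M} {T : Ty M} (h : ConfigOK N H T)
    (hT : T.Unr) : (N.IsValue ∧ H = ∅) ∨ ∃ c, Step (N, H) c := by
  obtain ⟨A, R, e, h, hA, hH⟩ := h
  rcases h.value_or_reducible hA with hV | ⟨E, N₀, rfl, hN₀⟩
  · refine .inl ⟨hV, Finmap.ext_lookup fun l => ?_⟩
    rw [Finmap.lookup_empty]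
    obtain ⟨L, hL, -, hcell⟩ := hH l
    cases hl : H.lookup l with
    | none => rfl
    | some c =>
      obtain ⟨h₁, -⟩ := hcell _ _ _ hl
      rcases L with _ | ⟨p, L⟩
      · simp at h₁
      · exact absurd ((hL.mem p.1 p.2).2 (by simp)) (h.value_unr hV hT _)
  · right
    rcases hN₀ with ⟨N', hN'⟩ | ⟨m, rfl⟩ | ⟨c, l, rfl⟩
    · exact ⟨_, .exp E _ _ H hN'⟩
    · obtain ⟨l, hl⟩ := Infinite.exists_notMem_finset H.keys
      exact ⟨_, .cfg E _ _ _ _ (.new m l H (by simpa [Finmap.mem_keys] using hl))⟩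
    · obtain ⟨A₀, S, e₀, h₀, hN₀, -, hmin, -⟩ := CTyping.fill E h hA
      obtain ⟨i, m, e', hA₀, hc, he'⟩ := hN₀.app_const_loc
      obtain ⟨n, m₀, m', L₁, L₂, hl, hL, hn, hprod, hfirst⟩ := (hH l).exists_of_mem h₀ hA₀
      cases hc with
      | op _ m₁ m₂ hm =>
        obtain rfl := hfirst (hmin (by rintro rfl; simp at he'))
        obtain ⟨p, hp, hprod⟩ := ProdLE.split (L₁ := []) hm hprod
        exact ⟨_, .cfg E _ _ _ _ (.op _ l H n m₀ m' p hl hp hprod.exists_mulLE)⟩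
      | split => exact ⟨_, .cfg E _ _ _ _ (.split _ _ l H n m₀ m' hl)⟩
      | drop _ hm =>
        cases n with
        | zero =>
          obtain ⟨h₁, h₂⟩ : L₁ = [] ∧ L₂ = [] := by simpa using hn
          subst h₁ h₂
          exact ⟨_, .cfg E _ _ _ _ (.dropLast l H m₀ m' hl (ProdLE.drop (L₁ := []) hm hprod))⟩
        | succ n => exact ⟨_, .cfg E _ _ _ _ (.dropShared l H n m₀ m' hl)⟩

theorem RTyping.lam_of_ctx {Γ Γ' : Ctx M} {U : Var → Ty M → Prop} {k : FunKind} {x : Var}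
    {N : Term M} {S T : Ty M} {e e' : Eff}
    (hx : Sum.inl x ∉ Γ.dom) (hΓ : Γ.Linear) (hU : ∀ y T, .var y T ∈ Γ.unrSet → U y T)
    (hk : k = .plain → Γ.Unr)
    (hΓ' : Γ' = .par Γ (.var x S) ∧ k ≠ .right ∧ k ≠ .left ∨
      Γ' = .seq Γ (.var x S) ∧ k ≠ .left ∨ Γ' = .seq (.var x S) Γ ∧ k ≠ .right)
    (hN : Γ'.Linear → ∀ U : Var → Ty M → Prop, (∀ y T, .var y T ∈ Γ'.unrSet → U y T) →
      RTyping U Γ'.toks Γ'.rel N T e) :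
    RTyping U Γ.toks Γ.rel (.lam k x N) (.arrow k S e T) e' := by
  have hxΓ : ∀ a ∈ Γ.toks, a.name ≠ Sum.inl x := fun a ha h => hx (h ▸ Ctx.name_mem_dom ha)
  have hx' : ∀ S', .var x S' ∉ Γ.toks := fun S' h => hxΓ _ h rfl
  have hxS : ∀ a, a ∈ (Ctx.var x S).toks ↔ a = .var x S ∧ ¬ S.Unr :=
    fun a => Ctx.mem_toks_single a
  have hxl := Ctx.linear_single (.var x S)
  have hxU : ∀ y T, .var y T ∈ (Ctx.var x S).unrSet → (y = x ∧ T = S) ∧ S.Unr := by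
    rintro y T ⟨h, h'⟩
    cases h
    exact ⟨⟨rfl, rfl⟩, h'⟩
  have hΓU : ∀ y T, Binding.var y T ∈ Γ.unrSet → y ≠ x := by
    rintro y T h rfl
    exact hx (Ctx.name_mem_dom_of_unr h)
  have hU' : ∀ y T, .var y T ∈ Γ.unrSet ∨ .var y T ∈ (Ctx.var x S).unrSet →
      bindUnr U x S y T := by
    rintro y T (h | h)
    · exact .inr ⟨hΓU y T h, hU y T h⟩
    · exact .inl ⟨(hxU y T h).1.1, (hxU y T h).1.2, (hxU y T h).2⟩
  have hname : ∀ a ∈ Γ.toks, ∀ b ∈ (Ctx.var x S).toks, a.name ≠ b.name := by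
    intro a ha b hb
    obtain ⟨rfl, -⟩ := (hxS b).1 hb
    exact hxΓ a ha
  refine .lam (A' := Γ'.toks) (R' := Γ'.rel) hx' (fun h => (hk h).notMem_toks) ?_ ?_ ?_ ?_
    (hN ?_ _ fun y T h => hU' y T ?_) <;>
  rcases hΓ' with ⟨rfl, h₁, h₂⟩ | ⟨rfl, h₁⟩ | ⟨rfl, h₁⟩
  · exact fun a => by rw [Ctx.mem_toks_par, hxS]
  · exact fun a => by rw [Ctx.mem_toks_seq, hxS]
  · exact fun a => by rw [Ctx.mem_toks_seq, hxS, or_comm]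
  · exact fun a _ b _ h => (Ctx.rel_par a b).2 (.inl h)
  · exact fun a _ b _ h => (Ctx.rel_seq a b).2 (.inl h)
  · exact fun a _ b _ h => (Ctx.rel_seq a b).2 (.inr (.inl h))
  · exact fun h => absurd h h₁
  · exact fun _ hS a ha => (Ctx.rel_seq _ _).2 (.inr (.inr ⟨ha, (hxS _).2 ⟨rfl, hS⟩⟩))
  · exact fun h => absurd h h₁
  · exact fun h => absurd h h₂
  · exact fun h => absurd h h₁
  · exact fun _ hS a ha => (Ctx.rel_seq _ _).2 (.inr (.inr ⟨(hxS _).2 ⟨rfl, hS⟩, ha⟩))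
  · exact Ctx.linear_par.2 ⟨hΓ, hxl, hname⟩
  · exact Ctx.linear_seq.2 ⟨hΓ, hxl, hname⟩
  · exact Ctx.linear_seq.2 ⟨hxl, hΓ, fun a ha b hb => (hname b hb a ha).symm⟩
  · exact h
  · exact h
  · exact h.symm

theorem RTyping.letPair_of_ctx {G : CtxPat M} {Γ : Ctx M} {U : Var → Ty M → Prop} {p : PairKind}
    {x y : Var} {N₁ N₂ : Term M} {S₁ S₂ T : Ty M} {e : Eff}
    (hxy : x ≠ y) (hx : Sum.inl x ∉ (G.fill Γ).dom) (hy : Sum.inl y ∉ (G.fill Γ).dom)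
    (hΓ : (G.fill Γ).Linear) (hU : ∀ y T, .var y T ∈ (G.fill Γ).unrSet → U y T)
    (h₁ : Γ.Linear → ∀ U : Var → Ty M → Prop, (∀ y T, .var y T ∈ Γ.unrSet → U y T) →
      RTyping U Γ.toks Γ.rel N₁ (.prod p S₁ S₂) 0)
    (h₂ : (G.fill (p.ctx (.var x S₁) (.var y S₂))).Linear → ∀ U : Var → Ty M → Prop,
      (∀ z T, .var z T ∈ (G.fill (p.ctx (.var x S₁) (.var y S₂))).unrSet → U z T) →
      RTyping U (G.fill (p.ctx (.var x S₁) (.var y S₂))).toks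
        (G.fill (p.ctx (.var x S₁) (.var y S₂))).rel N₂ T e) :
    RTyping U (G.fill Γ).toks (G.fill Γ).rel (.letPair p x y N₁ N₂) T e := by
  obtain ⟨B, C, D, Q, P, W, hB, hC, hQ, htoks, hrel, hlin, hunr⟩ := G.exists_spec
  have hxΓ : ∀ a ∈ (G.fill Γ).toks, a.name ≠ Sum.inl x := fun a ha h => hx (h ▸ Ctx.name_mem_dom ha)
  have hyΓ : ∀ a ∈ (G.fill Γ).toks, a.name ≠ Sum.inl y := fun a ha h => hy (h ▸ Ctx.name_mem_dom ha)
  have hxW : ∀ z T, Binding.var z T ∈ W → z ≠ x ∧ z ≠ y := by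
    intro z T h
    have h' : Binding.var z T ∈ (G.fill Γ).unrSet := by rw [hunr]; exact .inl h
    exact ⟨by rintro rfl; exact hx (Ctx.name_mem_dom_of_unr h'),
      by rintro rfl; exact hy (Ctx.name_mem_dom_of_unr h')⟩
  obtain ⟨hP, hΓl, hD⟩ := (hlin Γ).1 hΓ
  have hDΓ : ∀ a ∈ D, a ∉ Γ.toks := fun a ha ha' => hD a ha a ha' rfl
  generalize hΔ : p.ctx (.var x S₁) (.var y S₂) = Δ at h₂
  have hΔt : ∀ a, a ∈ Δ.toks ↔ (a = .var x S₁ ∧ ¬ S₁.Unr) ∨ (a = .var y S₂ ∧ ¬ S₂.Unr) := by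
    intro a
    subst hΔ
    cases p
    · exact (Ctx.mem_toks_par a).trans (or_congr (Ctx.mem_toks_single a) (Ctx.mem_toks_single a))
    · exact (Ctx.mem_toks_seq a).trans (or_congr (Ctx.mem_toks_single a) (Ctx.mem_toks_single a))
  have hΔl : Δ.Linear := by
    have : ∀ a ∈ (Ctx.var x S₁).toks, ∀ b ∈ (Ctx.var y S₂).toks, a.name ≠ b.name := by
      intro a ha b hb
      obtain ⟨rfl, -⟩ := (Ctx.mem_toks_single a).1 ha
      obtain ⟨rfl, -⟩ := (Ctx.mem_toks_single b).1 hb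
      exact fun h => hxy (Sum.inl_injective h)
    subst hΔ
    cases p
    · exact Ctx.linear_par.2 ⟨Ctx.linear_single _, Ctx.linear_single _, this⟩
    · exact Ctx.linear_seq.2 ⟨Ctx.linear_single _, Ctx.linear_single _, this⟩
  have hΔu : ∀ z T, .var z T ∈ Δ.unrSet → bindUnr (bindUnr U x S₁) y S₂ z T := by
    intro z T h
    have h : (Binding.var z T = .var x S₁ ∧ S₁.Unr) ∨ (Binding.var z T = .var y S₂ ∧ S₂.Unr) := by
      subst hΔ
      cases p <;> exact h
    rcases h with ⟨h, h'⟩ | ⟨h, h'⟩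
    · cases h
      exact .inr ⟨hxy, .inl ⟨rfl, rfl, h'⟩⟩
    · cases h
      exact .inl ⟨rfl, rfl, h'⟩
  have hΔr : p = .ord → ¬ S₁.Unr → ¬ S₂.Unr → Δ.rel (.var x S₁) (.var y S₂) := by
    rintro rfl hS₁ hS₂
    subst hΔ
    exact (Ctx.rel_seq _ _).2
      (.inr (.inr ⟨(Ctx.mem_toks_single _).2 ⟨rfl, hS₁⟩, (Ctx.mem_toks_single _).2 ⟨rfl, hS₂⟩⟩))
  have hΓr : ∀ a b, Γ.rel a b → a ∈ Γ.toks ∧ b ∈ Γ.toks := fun a b => Graph.rel.mem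
  have hDa : ∀ a ∈ (G.fill Γ).toks, a ∉ Γ.toks → a ∈ D := fun a ha ha' =>
    ((htoks Γ a).1 ha).resolve_right ha'
  have hin : ∀ a ∈ (G.fill Γ).toks, a ∉ Γ.toks → ∀ b ∈ Γ.toks, (G.fill Γ).rel a b → a ∈ B := by
    intro a ha ha' b hb hab
    rcases (hrel Γ a b).1 hab with h | h | h | h
    · exact absurd hb (hDΓ b (hQ a b h).2)
    · exact absurd (hΓr a b h).1 ha'
    · exact h.1
    · exact absurd h.1 ha'
  have hout : ∀ a ∈ (G.fill Γ).toks, a ∉ Γ.toks → ∀ b ∈ Γ.toks, (G.fill Γ).rel b a → a ∈ C := by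
    intro a ha ha' b hb hab
    rcases (hrel Γ b a).1 hab with h | h | h | h
    · exact absurd hb (hDΓ b (hQ b a h).1)
    · exact absurd (hΓr b a h).2 ha'
    · exact absurd h.2 ha'
    · exact h.2
  have hS₁t : ¬ S₁.Unr → .var x S₁ ∈ Δ.toks := fun h => (hΔt _).2 (.inl ⟨rfl, h⟩)
  have hS₂t : ¬ S₂.Unr → .var y S₂ ∈ Δ.toks := fun h => (hΔt _).2 (.inr ⟨rfl, h⟩)
  refine .letPair (A₀ := Γ.toks) (A' := (G.fill Δ).toks) (R' := (G.fill Δ).rel) hxy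
    (fun S' h => hxΓ _ h rfl) (fun S' h => hyΓ _ h rfl) (fun a h => (htoks Γ a).2 (.inr h)) ?_ ?_
    ?_ ?_ ?_ ?_ ?_ ((h₁ hΓl U fun z T h => hU z T ?_).weaken (fun _ _ h => h) ?_ le_rfl)
    (h₂ ((hlin Δ).2 ⟨hP, hΔl, ?_⟩) _ ?_)
  · intro a
    rw [htoks, htoks, hΔt]
    grind
  · intro a ha ha' b hb hb' hab
    refine (hrel Δ a b).2 (.inl ?_)
    rcases (hrel Γ a b).1 hab with h | h | h | h
    · exact h
    · exact absurd (hΓr a b h).1 ha'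
    · exact absurd h.2 hb'
    · exact absurd h.1 ha'
  · exact fun hS a ha ha' b hb hab =>
      (hrel Δ _ _).2 (.inr (.inr (.inl ⟨hin a ha ha' b hb hab, hS₁t hS⟩)))
  · exact fun hS a ha ha' b hb hab =>
      (hrel Δ _ _).2 (.inr (.inr (.inl ⟨hin a ha ha' b hb hab, hS₂t hS⟩)))
  · exact fun hS a ha ha' b hb hab =>
      (hrel Δ _ _).2 (.inr (.inr (.inr ⟨hS₁t hS, hout a ha ha' b hb hab⟩)))
  · exact fun hS a ha ha' b hb hab =>
      (hrel Δ _ _).2 (.inr (.inr (.inr ⟨hS₂t hS, hout a ha ha' b hb hab⟩)))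
  · exact fun hp hS₁ hS₂ => (hrel Δ _ _).2 (.inr (.inl (hΔr hp hS₁ hS₂)))
  · rw [hunr]
    exact .inr h
  · intro a ha b hb hab
    rcases (hrel Γ a b).1 hab with h | h | h | h
    · exact absurd ha (hDΓ a (hQ a b h).1)
    · exact h
    · exact absurd ha (hDΓ a (hB a h.1))
    · exact absurd hb (hDΓ b (hC b h.2))
  · intro a ha b hb
    have ha' := (htoks Γ a).2 (.inl ha)
    rcases (hΔt b).1 hb with ⟨rfl, -⟩ | ⟨rfl, -⟩
    exacts [hxΓ a ha', hyΓ a ha']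
  · intro z T h
    rw [hunr] at h
    rcases h with h | h
    · obtain ⟨h₁, h₂⟩ := hxW z T h
      exact .inr ⟨h₂, .inr ⟨h₁, hU z T (by rw [hunr]; exact .inl h)⟩⟩
    · exact hΔu z T h

theorem Typing.toRTyping {Γ : Ctx M} {N : Term M} {T : Ty M} {e : Eff} (h : Typing Γ N T e)
    (hΓ : Γ.Linear) (U : Var → Ty M → Prop) (hU : ∀ x T, .var x T ∈ Γ.unrSet → U x T) :
    RTyping U Γ.toks Γ.rel N T e := by
  induction h generalizing U with
  | unit => exact .const .unit Ctx.mem_toks_empty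
  | new m => exact .const (.new m) Ctx.mem_toks_empty
  | op m₀ m₁ m₂ h => exact .const (.op m₀ m₁ m₂ h) Ctx.mem_toks_empty
  | split m₀ m₁ m₂ h => exact .const (.split m₀ m₁ m₂ h) Ctx.mem_toks_empty
  | drop m h => exact .const (.drop m h) Ctx.mem_toks_empty
  | var x T =>
    by_cases hT : T.Unr
    · exact .uvar (hU x T ⟨rfl, hT⟩) fun a ha => ((Ctx.mem_toks_single a).1 ha).2 hT
    · exact .ovar fun a => (Ctx.mem_toks_single a).trans (and_iff_left hT)
  | loc l m => exact .loc 0 fun a => (Ctx.mem_toks_single a).trans (and_iff_left nofun)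
  | abs hx hΓ' hN ih =>
    exact .lam_of_ctx hx hΓ hU (fun _ => hΓ') (.inr (.inl ⟨rfl, nofun⟩)) ih
  | uabs hx hN ih => exact .lam_of_ctx hx hΓ hU nofun (.inl ⟨rfl, nofun, nofun⟩) ih
  | rabs hx hN ih => exact .lam_of_ctx hx hΓ hU nofun (.inr (.inl ⟨rfl, nofun⟩)) ih
  | labs hx hN ih => exact .lam_of_ctx hx hΓ hU nofun (.inr (.inr ⟨rfl, nofun⟩)) ih
  | app h₁ h₂ ih₁ ih₂ =>
    obtain ⟨r₁, r₂, r₃, r₄⟩ := Ctx.rel_seq_restrict hΓ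
    obtain ⟨l₁, l₂, -⟩ := Ctx.linear_seq.1 hΓ
    exact .app Ctx.mem_toks_seq r₄ ⟨fun _ => r₃, by simp⟩ nofun nofun
      ((ih₁ l₁ U fun x T h => hU x T (.inl h)).weaken (fun _ _ h => h) r₁ le_rfl)
      ((ih₂ l₂ U fun x T h => hU x T (.inr h)).weaken (fun _ _ h => h) r₂ le_rfl)
      (le_sup_left.trans le_sup_left) (le_sup_right.trans le_sup_left) le_sup_right
  | uapp h₁ h₂ ih₁ ih₂ =>
    obtain ⟨r₁, r₂, r₃, r₄⟩ := Ctx.rel_par_restrict hΓ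
    obtain ⟨l₁, l₂, -⟩ := Ctx.linear_par.1 hΓ
    exact .app Ctx.mem_toks_par r₄
      ⟨fun _ a ha b hb => (r₃ a ha b hb).1, fun _ a ha b hb => (r₃ a ha b hb).2⟩ nofun nofun
      ((ih₁ l₁ U fun x T h => hU x T (.inl h)).weaken (fun _ _ h => h) r₁ le_rfl)
      ((ih₂ l₂ U fun x T h => hU x T (.inr h)).weaken (fun _ _ h => h) r₂ le_rfl)
      (le_sup_left.trans le_sup_left) (le_sup_right.trans le_sup_left) le_sup_right
  | rapp h₁ h₂ ih₁ ih₂ =>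
    obtain ⟨r₁, r₂, r₃, r₄⟩ := Ctx.rel_seq_restrict hΓ
    obtain ⟨l₁, l₂, -⟩ := Ctx.linear_seq.1 hΓ
    exact .app Ctx.mem_toks_seq r₄ ⟨fun _ => r₃, by simp⟩ (fun _ => rfl) nofun
      ((ih₁ l₁ U fun x T h => hU x T (.inl h)).weaken (fun _ _ h => h) r₁ le_rfl)
      ((ih₂ l₂ U fun x T h => hU x T (.inr h)).weaken (fun _ _ h => h) r₂ le_rfl)
      le_sup_left le_sup_right (Fin.zero_le _)
  | lapp h₁ h₂ ih₁ ih₂ =>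
    obtain ⟨r₁, r₂, r₃, r₄⟩ := Ctx.rel_seq_restrict hΓ
    obtain ⟨l₁, l₂, -⟩ := Ctx.linear_seq.1 hΓ
    exact .app (fun a => (Ctx.mem_toks_seq a).trans or_comm) (fun a ha ha' => r₄ a ha' ha)
      ⟨by simp, fun _ a ha b hb => r₃ b hb a ha⟩ nofun (fun _ => rfl)
      ((ih₁ l₂ U fun x T h => hU x T (.inr h)).weaken (fun _ _ h => h) r₂ le_rfl)
      ((ih₂ l₁ U fun x T h => hU x T (.inl h)).weaken (fun _ _ h => h) r₁ le_rfl)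
      le_sup_left (Fin.zero_le _) le_sup_right
  | upair h₁ h₂ ih₁ ih₂ =>
    obtain ⟨r₁, r₂, r₃, r₄⟩ := Ctx.rel_par_restrict hΓ
    obtain ⟨l₁, l₂, -⟩ := Ctx.linear_par.1 hΓ
    exact .pair Ctx.mem_toks_par r₄
      ⟨fun a ha b hb => (r₃ a ha b hb).1, fun _ a ha b hb => (r₃ a ha b hb).2⟩ nofun
      ((ih₁ l₁ U fun x T h => hU x T (.inl h)).weaken (fun _ _ h => h) r₁ le_rfl)
      ((ih₂ l₂ U fun x T h => hU x T (.inr h)).weaken (fun _ _ h => h) r₂ le_rfl)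
      le_sup_left le_sup_right
  | opair hS h₁ h₂ ih₁ ih₂ =>
    obtain ⟨r₁, r₂, r₃, r₄⟩ := Ctx.rel_seq_restrict hΓ
    obtain ⟨l₁, l₂, -⟩ := Ctx.linear_seq.1 hΓ
    exact .pair Ctx.mem_toks_seq r₄ ⟨r₃, nofun⟩ (fun _ h => hS ((Ty.ord_iff_not_unr _).2 h))
      ((ih₁ l₁ U fun x T h => hU x T (.inl h)).weaken (fun _ _ h => h) r₁ le_rfl)
      ((ih₂ l₂ U fun x T h => hU x T (.inr h)).weaken (fun _ _ h => h) r₂ le_rfl)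
      le_sup_left le_sup_right
  | ulet hxy hx hy h₁ h₂ ih₁ ih₂ => exact .letPair_of_ctx (p := .unord) hxy hx hy hΓ hU ih₁ ih₂
  | olet hxy hx hy h₁ h₂ ih₁ ih₂ => exact .letPair_of_ctx (p := .ord) hxy hx hy hΓ hU ih₁ ih₂
  | weaken h hsub he ih =>
    obtain ⟨h₁, h₂, h₃⟩ := hsub.spec
    exact ((ih (h₃.1 hΓ) U fun x T h => hU x T (hsub.2 h)).weaken (fun _ _ h => h)
      (fun a _ b _ => h₂ a b) he).congr h₁

theorem ConfigOK.of_typing {N : Term M} {T : Ty M} {e : Eff} (h : Typing .empty N T e) :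
    ConfigOK N ∅ T := by
  refine ⟨_, _, e, h.toRTyping (fun i => i.elim0) _ fun _ _ h => h.elim,
    fun a ha => absurd ha (Ctx.mem_toks_empty a), fun l => ⟨[], ⟨List.nodup_nil, ?_, .nil⟩, ?_⟩⟩
  · exact fun i m => iff_of_false (Ctx.mem_toks_empty _) (by simp)
  · simp [Finmap.lookup_empty]

theorem value_or_diverges {N : Term M} {H : Heap M}
    (h : ∀ N' H', Steps (N, H) (N', H') → (N'.IsValue ∧ H' = ∅) ∨ ∃ c, Step (N', H') c) :
    (∃ V : Term M, V.IsValue ∧ Steps (N, H) (V, ∅)) ∨ Diverges (N, H) := by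
  by_contra! hcon
  have hstep : ∀ c : {c : Config M // Steps (N, H) c}, ∃ c' : {c : Config M // Steps (N, H) c},
      Step c.1 c'.1 := by
    rintro ⟨⟨N', H'⟩, hc⟩
    rcases h N' H' hc with ⟨hV, rfl⟩ | ⟨c', hc'⟩
    · exact absurd hc (hcon.1 N' hV)
    · exact ⟨⟨c', hc.tail hc'⟩, hc'⟩
  choose f hf using hstep
  have hrefl : Steps (N, H) (N, H) := Relation.ReflTransGen.refl
  refine hcon.2 ⟨fun n => (f^[n] ⟨(N, H), hrefl⟩).1, rfl, fun n => ?_⟩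
  simpa only [Function.iterate_succ_apply'] using hf (f^[n] ⟨(N, H), hrefl⟩)

end OrderedBorrow

theorem mainTheorem1 {M : Type*} [OrderedBorrow.OPM M]
    (N : OrderedBorrow.Term M) (T : OrderedBorrow.Ty M) (e : OrderedBorrow.Eff)
    (hN : OrderedBorrow.Typing .empty N T e) (hT : T.Unr) :
    ((∃ V : OrderedBorrow.Term M, V.IsValue ∧ OrderedBorrow.Steps (N, ∅) (V, ∅)) ∨
      OrderedBorrow.Diverges (N, (∅ : OrderedBorrow.Heap M))) ∧
    ∀ (N' : OrderedBorrow.Term M) (H : OrderedBorrow.Heap M),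
      OrderedBorrow.Steps (N, ∅) (N', H) →
        ((N'.IsValue ∧ H = ∅) ∨ ∃ c : OrderedBorrow.Config M, OrderedBorrow.Step (N', H) c) ∧
        ∀ (l : OrderedBorrow.Loc) (n : ℕ) (m₀ m : M),
          H.lookup l = some ⟨n, m₀, m⟩ → ∃ m' : M, OrderedBorrow.MulLE m m' m₀ := by
  have h := OrderedBorrow.ConfigOK.of_typing hN
  exact ⟨OrderedBorrow.value_or_diverges fun N' H hs => (h.steps hs).value_or_step hT,
    fun N' H hs => ⟨(h.steps hs).value_or_step hT, (h.steps hs).admissible⟩⟩
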